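/- Let $s\ge 1$ and let $M$ be an integer $s\times s$ dilation matrix, i.e. $\det M\neq 0$ and $\rho(M^{-1})<1$. Let $E$ be a complete set of representatives of $\mathbb Z^s/M\mathbb Z^s$, let $N\in\mathbb N_0$, and let $G\subset\mathbb Z^s$ be any finite set containing $\{0,\dots,N\}^s-E$ (for $M=mI$, $m\ge 2$, $E=\{0,\dots,m-1\}^s$ one may take $G=\{-m,\dots,N+1\}^s$). All masks are real sequences on $\mathbb Z^s$ supported in $\{0,\dots,N\}^s$. The subdivision operator of a mask $\mathbf a$ is $S_{\mathbf a}\mathbf c(\alpha)=\sum_{\beta\in\mathbb Z^s}\mathbf a(\alpha-M\beta)c(\beta)$; a non-stationary scheme $\{S_{\mathbf a^{(k)}},k\ge1\}$ is given by a sequence of masks. A *test function* is a continuous compactly supported $f:\mathbb R^s\to\mathbb R$ which is stable (there are $0<C_1\le C_2<\infty$ with $C_1\|\mathbf c\|_{\ell_\infty}\le\|\sum_\alpha c(\alpha)f(\cdot-\alpha)\|_\infty\le C_2\|\mathbf c\|_{\ell_\infty}$ for all $\mathbf c\in\ell_\infty(\mathbb Z^s)$) and satisfies $\hat f(0)=1$,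 $\hat f(\alpha)=0$ for $\alpha\in\mathbb Z^s\setminus\{0\}$, where $\hat f(\xi)=\int f(x)e^{-2\pi i x\cdot\xi}dx$. The scheme is *$C^0$-convergent* if for every $\mathbf c\in\ell_\infty(\mathbb Z^s)$ there is a continuous $g_{\mathbf c}:\mathbb R^s\to\mathbb R$ such that for every test function $f$ $$\lim_{k\to\infty}\Big\|g_{\mathbf c}-\sum_{\alpha\in\mathbb Z^s}\big(S_{\mathbf a^{(k)}}\cdots S_{\mathbf a^{(1)}}\mathbf c\big)(\alpha)\,f(M^k\cdot-\alpha)\Big\|_\infty=0 .$$ The *set of limit points* of a mask sequence is the set of limits of its convergent subsequences; two schemes are *asymptotically similar* if their sets of limit points coincide. With the symbol $a_*(z)=\sum_\alpha \mathbf a(\alpha)z^\alpha$ and $\Xi=\{e^{2\pi i M^{-T}\xi}:\xi\in\mathbb Z^s\}$ (a finite set), the masks $\mathbf a^{(k)}$ satisfy *approximate sum rules of order 1* if $$\sum_{k\ge1}\big|a^{(k)}_*(1)-|\det M|\big|<\infty\quad\text{and}\quad \sum_{k\ge1}\max_{\epsilon\in\Xi\setminus\{1\}}|a_*^{(k)}(\epsilon)|<\infty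 .$$ Let $K=\mathbb Z^s\cap\{\sum_{r\ge1}M^{-r}g_r: g_r\in G\}$ (a finite set), $T_{\varepsilon,\mathbf a}=[\mathbf a(\varepsilon+M\alpha-\beta)]_{\alpha,\beta\in K}$ for $\varepsilon\in E$, and $V_0=\{v\in\mathbb R^{K}:\sum_{\alpha\in K}v_\alpha=0\}$. For a set $\mathcal A$ of masks let $\mathcal T_{\mathcal A}|_{V_0}=\{T_{\varepsilon,\mathbf a}|_{V_0}:\varepsilon\in E,\ \mathbf a\in\mathcal A\}$, where $T_{\varepsilon,\mathbf a}|_{V_0}$ is regarded as an endomorphism of $V_0$ (if $T_{\varepsilon,\mathbf a}$ leaves $V_0$ invariant, which under the hypotheses below is always the case for the limit points), and let $\rho(\mathcal M)=\lim_{n\to\infty}\sup_{M_1,\dots,M_n\in\mathcal M}\|M_1\cdots M_n\|^{1/n}$ denote the joint spectral radius. **Corollary 2.** Let $\{S_{\mathbf a^{(k)}},k\ge1\}$ be a $C^0$-convergent scheme with set of limit points $\mathcal A$ such that $\rho(\mathcal T_{\mathcal A}|_{V_0})<1$. Then every scheme $\{S_{\mathbf b^{(k)}},k\ge1\}$ whose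 masks are uniformly bounded ($\sup_{k,\alpha}|\mathbf b^{(k)}(\alpha)|<\infty$), which is asymptotically similar to $\{S_{\mathbf a^{(k)}},k\ge1\}$ and satisfies approximate sum rules of order 1, is $C^0$-convergent. -/

import Mathlib

open Filter Topology MeasureTheory
open scoped ENNReal Matrix

namespace NonstationarySubdivision

/-! ### Dilation matrices, masks, subdivision operators -/

/-- The integer matrix `M` regarded as a real matrix. -/
def realMat {s : ℕ} (M : Matrix (Fin s) (Fin s) ℤ) : Matrix (Fin s) (Fin s) ℝ :=
  M.map (Int.cast : ℤ → ℝ)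

/-- The lattice point `α ∈ ℤ^s` regarded as a point of `ℝ^s`. -/
def realVec {s : ℕ} (α : Fin s → ℤ) : Fin s → ℝ := fun i => (α i : ℝ)

/-- `M` is an integer dilation matrix: `M` is invertible over the reals and `ρ(M⁻¹) < 1`
(the spectral radius is computed over `ℂ`). -/
def IsDilation {s : ℕ} (M : Matrix (Fin s) (Fin s) ℤ) : Prop :=
  M.det ≠ 0 ∧ spectralRadius ℂ (M.map (Int.cast : ℤ → ℂ))⁻¹ < 1

/-- `E` is a complete set of representatives of `ℤ^s / M ℤ^s`. -/
def IsCosetReps {s : ℕ} (M : Matrix (Fin s) (Fin s) ℤ) (E : Finset (Fin s → ℤ)) : Prop :=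
  ∀ x : Fin s → ℤ, ∃! ε : Fin s → ℤ, ε ∈ E ∧ ∃ y : Fin s → ℤ, x = ε + M *ᵥ y

/-- Real masks `a = {a(α), α ∈ ℤ^s}`. -/
abbrev Mask (s : ℕ) : Type := (Fin s → ℤ) → ℝ

/-- The cube `{0, …, N}^s`. -/
def cube (s N : ℕ) : Set (Fin s → ℤ) := {α | ∀ i, 0 ≤ α i ∧ α i ≤ (N : ℤ)}

/-- The mask is supported in `{0, …, N}^s`. -/
def Mask.SupportedIn {s : ℕ} (a : Mask s) (N : ℕ) : Prop := ∀ α, α ∉ cube s N → a α = 0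

/-- The subdivision operator `(S_a c)(α) = ∑_β a(α - Mβ) c(β)`
(a finite sum for masks of finite support and invertible `M`). -/
noncomputable def subdivision {s : ℕ} (M : Matrix (Fin s) (Fin s) ℤ) (a : Mask s)
    (c : (Fin s → ℤ) → ℝ) : (Fin s → ℤ) → ℝ :=
  fun α => ∑' β : Fin s → ℤ, a (α - M *ᵥ β) * c β

/-- Level-dependent masks are given as a sequence `a : ℕ → Mask s`, where `a k` is the mask
`a^{(k+1)}` of level `k + 1`. The data after `k` steps is
`S_{a^{(k)}} ⋯ S_{a^{(1)}} c`. -/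
noncomputable def iterate {s : ℕ} (M : Matrix (Fin s) (Fin s) ℤ) (a : ℕ → Mask s)
    (c : (Fin s → ℤ) → ℝ) : ℕ → (Fin s → ℤ) → ℝ
  | 0 => c
  | k + 1 => subdivision M (a k) (iterate M a c k)

/-! ### `C^0`-convergence -/

/-- Bounded sequences on `ℤ^s`, i.e. elements of `ℓ_∞(ℤ^s)`. -/
def IsBoundedSeq {s : ℕ} (c : (Fin s → ℤ) → ℝ) : Prop := ∃ C : ℝ, ∀ α, |c α| ≤ C

/-- The Fourier transform `∫ e^{-2πi x·ξ} f(x) dx` of an integrable function on `ℝ^s`. -/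
noncomputable def fourier {s : ℕ} (f : (Fin s → ℝ) → ℝ) (ξ : Fin s → ℝ) : ℂ :=
  ∫ x : Fin s → ℝ,
    Complex.exp (-(2 * (Real.pi : ℂ) * Complex.I * ((x ⬝ᵥ ξ : ℝ) : ℂ))) * (f x : ℂ)

/-- Stability of `f`:
`C₁ ‖c‖_∞ ≤ ‖∑_α c(α) f(· - α)‖_{L_∞} ≤ C₂ ‖c‖_∞` for all bounded sequences `c`. -/
def IsStable {s : ℕ} (f : (Fin s → ℝ) → ℝ) : Prop :=
  ∃ C₁ C₂ : ℝ, 0 < C₁ ∧ C₁ ≤ C₂ ∧ ∀ c : (Fin s → ℤ) → ℝ, IsBoundedSeq c →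
    ENNReal.ofReal C₁ * (⨆ α, ‖c α‖ₑ) ≤
        eLpNorm (fun x : Fin s → ℝ => ∑' α : Fin s → ℤ, c α * f (x - realVec α)) ∞ volume ∧
      eLpNorm (fun x : Fin s → ℝ => ∑' α : Fin s → ℤ, c α * f (x - realVec α)) ∞ volume ≤
        ENNReal.ofReal C₂ * (⨆ α, ‖c α‖ₑ)

/-- Test functions for `C^0`-convergence: continuous, compactly supported, stable functions
that satisfy the Strang-Fix conditions of order `1`. -/
structure IsTestFunction {s : ℕ} (f : (Fin s → ℝ) → ℝ) : Prop where
  continuous : Continuous f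
  hasCompactSupport : HasCompactSupport f
  stable : IsStable f
  fourier_zero : fourier f 0 = 1
  fourier_lattice : ∀ α : Fin s → ℤ, α ≠ 0 → fourier f (realVec α) = 0

/-- `C^0`-convergence of the scheme with masks `a`: for every bounded initial sequence `c` there
is a continuous `g` such that for every test function `f` the functions
`∑_α (S_{a^{(k)}} ⋯ S_{a^{(1)}} c)(α) f(M^k · - α)` converge to `g` uniformly on `ℝ^s`. -/
def C0Convergent {s : ℕ} (M : Matrix (Fin s) (Fin s) ℤ) (a : ℕ → Mask s) : Prop :=
  ∀ c : (Fin s → ℤ) → ℝ, IsBoundedSeq c →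
    ∃ g : (Fin s → ℝ) → ℝ, Continuous g ∧
      ∀ f : (Fin s → ℝ) → ℝ, IsTestFunction f →
        TendstoUniformly
          (fun (k : ℕ) (x : Fin s → ℝ) =>
            ∑' α : Fin s → ℤ, iterate M a c k α * f ((realMat M) ^ k *ᵥ x - realVec α))
          g atTop

/-! ### Limit points and asymptotic similarity -/

/-- The set of limit points of a sequence of masks, i.e. of limits of its subsequences.
(For masks with supports in a fixed finite set, the pointwise convergence used here is
convergence in norm.) -/
def limitPoints {s : ℕ} (a : ℕ → Mask s) : Set (Mask s) :=
  {x | ∃ φ : ℕ → ℕ, StrictMono φ ∧ Tendsto (fun n => a (φ n)) atTop (𝓝 x)}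

/-- Two schemes are asymptotically similar if their sets of limit points coincide. -/
def AsymptoticallySimilar {s : ℕ} (a b : ℕ → Mask s) : Prop := limitPoints a = limitPoints b

/-! ### Approximate sum rules of order `1` -/

/-- The symbol `a_*(z) = ∑_α a(α) z^α`. -/
noncomputable def symbol {s : ℕ} (a : Mask s) (z : Fin s → ℂ) : ℂ :=
  ∑' α : Fin s → ℤ, (a α : ℂ) * ∏ j, z j ^ α j

/-- The finite set `Ξ = {e^{2πi M^{-T} ξ}}`; the point depends only on the coset
`ξ + M^T ℤ^s`, so that `ξ` may run through all of `ℤ^s`. -/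
noncomputable def Xi {s : ℕ} (M : Matrix (Fin s) (Fin s) ℤ) : Set (Fin s → ℂ) :=
  Set.range fun (ξ : Fin s → ℤ) (j : Fin s) =>
    Complex.exp (2 * (Real.pi : ℂ) * Complex.I * ((((realMat M)ᵀ⁻¹ *ᵥ realVec ξ) j : ℝ) : ℂ))

/-- `μ = |a_*(1) - |det M||`. -/
noncomputable def normalizationDefect {s : ℕ} (M : Matrix (Fin s) (Fin s) ℤ) (a : Mask s) : ℝ :=
  ‖symbol a 1 - ((|M.det| : ℤ) : ℂ)‖

/-- `δ = max_{ε ∈ Ξ \ {1}} |a_*(ε)|`. -/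
noncomputable def sumRuleDefect {s : ℕ} (M : Matrix (Fin s) (Fin s) ℤ) (a : Mask s) : ℝ :=
  sSup ((fun z => ‖symbol a z‖) '' (Xi M \ {1}))

/-- Approximate sum rules of order `1`: the defects `μ_k` and `δ_k` are summable. -/
def ApproxSumRules {s : ℕ} (M : Matrix (Fin s) (Fin s) ℤ) (a : ℕ → Mask s) : Prop :=
  (Summable fun k => normalizationDefect M (a k)) ∧ Summable fun k => sumRuleDefect M (a k)

/-! ### The index set `K`, transition matrices, joint spectral radius -/

/-- The lattice points of `∑_{r ≥ 1} M^{-r} G = {∑_{r ≥ 1} M^{-r} g_r : g_r ∈ G}`. -/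
def attractorPoints {s : ℕ} (M : Matrix (Fin s) (Fin s) ℤ) (G : Finset (Fin s → ℤ)) :
    Set (Fin s → ℤ) :=
  {α | ∃ g : ℕ → Fin s → ℤ, (∀ r, g r ∈ G) ∧
    HasSum (fun r => (realMat M)⁻¹ ^ (r + 1) *ᵥ realVec (g r)) (realVec α)}

theorem summable_norm_inv_pow_mulVec {s : ℕ} {M : Matrix (Fin s) (Fin s) ℤ}
    (hM : IsDilation M) :
    ∃ u : ℕ → ℝ, Summable u ∧ ∀ (r : ℕ) (v : Fin s → ℝ),
      ‖(realMat M)⁻¹ ^ (r + 1) *ᵥ v‖ ≤ u r * ‖v‖ := by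
  let _ : NormedRing (Matrix (Fin s) (Fin s) ℂ) := Matrix.linftyOpNormedRing
  let _ : NormedAlgebra ℂ (Matrix (Fin s) (Fin s) ℂ) := Matrix.linftyOpNormedAlgebra
  let _ : NormedRing (Matrix (Fin s) (Fin s) ℝ) := Matrix.linftyOpNormedRing
  have _ : CompleteSpace (Matrix (Fin s) (Fin s) ℂ) := FiniteDimensional.complete ℂ _
  obtain ⟨hdet, hsp⟩ := hM
  set A : Matrix (Fin s) (Fin s) ℂ := (M.map (Int.cast : ℤ → ℂ))⁻¹ with hA
  have hBA : (realMat M)⁻¹.map (Complex.ofRealHom : ℝ →+* ℂ) = A := by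
    rw [hA]
    symm
    apply Matrix.inv_eq_right_inv
    have h1 : M.map (Int.cast : ℤ → ℂ)
        = (realMat M).map (Complex.ofRealHom : ℝ →+* ℂ) := by
      ext i j
      simp [realMat]
    have h2 : IsUnit (realMat M).det := by
      have : (realMat M).det = (M.det : ℝ) := by
        have := (Int.castRingHom ℝ).map_det M
        simpa [realMat] using this.symm
      rw [this, isUnit_iff_ne_zero]
      exact_mod_cast hdet
    rw [h1, ← Matrix.map_mul, Matrix.mul_nonsing_inv _ h2]
    simp
  have hnorm : ∀ n : ℕ, ‖(realMat M)⁻¹ ^ n‖ = ‖A ^ n‖ := by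
    intro n
    have h3 : A ^ n = ((realMat M)⁻¹ ^ n).map (Complex.ofRealHom : ℝ →+* ℂ) := by
      rw [← hBA]
      exact ((Complex.ofRealHom.mapMatrix).map_pow ((realMat M)⁻¹) n).symm
    rw [h3, Matrix.linfty_opNorm_def, Matrix.linfty_opNorm_def]
    simp
  obtain ⟨q, hq1, hq2⟩ := ENNReal.lt_iff_exists_nnreal_btwn.1 hsp
  have hq2' : q < 1 := by exact_mod_cast hq2
  have hev : ∀ᶠ n : ℕ in atTop, ‖A ^ n‖ ≤ (q : ℝ) ^ n := by
    have h4 := (spectrum.pow_nnnorm_pow_one_div_tendsto_nhds_spectralRadius A).eventually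
      (gt_mem_nhds hq1)
    filter_upwards [h4, eventually_gt_atTop 0] with n hn hn0
    have hn' : (‖A ^ n‖₊ : ℝ≥0∞) ≤ (q : ℝ≥0∞) ^ (n : ℝ) := by
      have h5 := ENNReal.rpow_le_rpow hn.le (Nat.cast_nonneg n : (0 : ℝ) ≤ n)
      rwa [← ENNReal.rpow_mul, one_div,
        inv_mul_cancel₀ (by positivity : (n : ℝ) ≠ 0), ENNReal.rpow_one] at h5
    rw [ENNReal.rpow_natCast] at hn'
    exact_mod_cast hn'
  refine ⟨fun r => ‖A ^ (r + 1)‖, ?_, fun r v => ?_⟩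
  · rw [summable_nat_add_iff (f := fun n => ‖A ^ n‖) 1]
    refine Summable.of_norm_bounded_eventually_nat
      (summable_geometric_of_lt_one q.2 (by exact_mod_cast hq2')) ?_
    filter_upwards [hev] with n hn
    simpa using hn
  · simp only [← hnorm]
    exact Matrix.linfty_opNorm_mulVec _ _

/-- There are finitely many such lattice points. -/
theorem attractorPoints_finite {s : ℕ} {M : Matrix (Fin s) (Fin s) ℤ} (hM : IsDilation M)
    (G : Finset (Fin s → ℤ)) : (attractorPoints M G).Finite := by
  obtain ⟨u, hu, hub⟩ := summable_norm_inv_pow_mulVec hM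
  obtain ⟨C, hC⟩ : ∃ C : ℝ, ∀ g ∈ G, ‖realVec g‖ ≤ C :=
    ⟨∑ g ∈ G, ‖realVec g‖, fun g hg =>
      Finset.single_le_sum (f := fun g => ‖realVec g‖) (fun _ _ => norm_nonneg _) hg⟩
  have hbound : ∀ α ∈ attractorPoints M G, ‖realVec α‖ ≤ ∑' r, |u r| * C := by
    rintro α ⟨g, hg, hsum⟩
    rw [← hsum.tsum_eq]
    refine tsum_of_norm_bounded (hu.abs.mul_right C).hasSum fun r => ?_
    calc _ ≤ u r * ‖realVec (g r)‖ := hub r _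
      _ ≤ |u r| * ‖realVec (g r)‖ := by gcongr; exact le_abs_self _
      _ ≤ |u r| * C := by gcongr; exact hC _ (hg r)
  refine (Set.finite_Icc (fun _ : Fin s => -⌈∑' r, |u r| * C⌉)
    (fun _ => ⌈∑' r, |u r| * C⌉)).subset fun α hα => ?_
  have h1 : ∀ i, |(α i : ℝ)| ≤ (⌈∑' r, |u r| * C⌉ : ℝ) := fun i =>
    ((norm_le_pi_norm (realVec α) i).trans (hbound α hα)).trans (Int.le_ceil _)
  exact ⟨fun i => by exact_mod_cast (abs_le.1 (h1 i)).1,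
    fun i => by exact_mod_cast (abs_le.1 (h1 i)).2⟩

/-- The finite index set `K = ℤ^s ∩ ∑_{r ≥ 1} M^{-r} G`. -/
noncomputable def indexSet {s : ℕ} {M : Matrix (Fin s) (Fin s) ℤ} (hM : IsDilation M)
    (G : Finset (Fin s → ℤ)) : Finset (Fin s → ℤ) :=
  (attractorPoints_finite hM G).toFinset

/-- The transition matrix `T_{ε,a} = [a(ε + Mα - β)]_{α,β ∈ K}`. -/
def transitionMatrix {s : ℕ} (M : Matrix (Fin s) (Fin s) ℤ) (K : Finset (Fin s → ℤ))
    (ε : Fin s → ℤ) (a : Mask s) : Matrix K K ℝ :=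
  Matrix.of fun α β => a (ε + M *ᵥ α.1 - β.1)

/-- The difference space `V_0 = {v ∈ ℝ^K : ∑_α v_α = 0}`. -/
def diffSpace {s : ℕ} (K : Finset (Fin s → ℤ)) : Submodule ℝ (K → ℝ) where
  carrier := {v | ∑ α, v α = 0}
  add_mem' := by
    intro v w hv hw
    simp only [Set.mem_ofPred_eq, Pi.add_apply, Finset.sum_add_distrib] at *
    rw [hv, hw, add_zero]
  zero_mem' := by simp
  smul_mem' := by
    intro t v hv
    simp only [Set.mem_ofPred_eq, Pi.smul_apply, smul_eq_mul, ← Finset.mul_sum] at *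
    rw [hv, mul_zero]

/-- The family `𝒯_𝒜|_{V_0} = {T_{ε,a}|_{V_0} : ε ∈ E, a ∈ 𝒜}` of endomorphisms of `V_0` that
are restrictions of transition matrices. (If the limit points of a scheme satisfy the sum rules of
order `1`, all the transition matrices leave `V_0` invariant and so have a restriction.) -/
def restrictedFamily {s : ℕ} (M : Matrix (Fin s) (Fin s) ℤ) (K E : Finset (Fin s → ℤ))
    (A : Set (Mask s)) : Set (diffSpace K →L[ℝ] diffSpace K) :=
  {L | ∃ ε ∈ E, ∃ a ∈ A, ∀ v : diffSpace K,
    (L v : K → ℝ) = transitionMatrix M K ε a *ᵥ (v : K → ℝ)}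

/-- The joint spectral radius
`lim_{n → ∞} sup_{M₁, …, M_n ∈ 𝓜} ‖M₁ ⋯ M_n‖^{1/n}`, as an extended nonnegative number; for
bounded `𝓜` the limit exists by submultiplicativity, so that it equals the `limsup`. -/
noncomputable def jointSpectralRadius {R : Type*} [NormedRing R] (𝓜 : Set R) : ℝ≥0∞ :=
  limsup (fun n : ℕ =>
    (⨆ w : Fin n → 𝓜, ‖(List.ofFn fun i => (w i : R)).prod‖ₑ) ^ (1 / (n : ℝ))) atTop

end NonstationarySubdivision

namespace NonstationarySubdivision

/-! ### Partition of unity -/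

/-! Let `τ k` be the sum of the two sum rule defects of the mask `b k`. Orthogonality of the
characters of `ℤ^s / Mℤ^s` turns a small defect into a pointwise statement: `S_b 1` differs from the
constant `1` by at most `τ k` (`abs_subdivision_one_sub_one_le`). Limit points of the masks
therefore reproduce constants exactly, their transition matrices act on `V_0`, and joint spectral
radius below `1` yields an equivalent norm `ν` on `V_0` contracted by all of them with one factor `q
< 1` (`exists_adapted_norm`). By compactness the masks are eventually as close to limit points as
desired (`eventually_near_limitPoints`).

Two quantities are followed from level to level: a sup bound `C k` of the data, and a bound `D k`,
relative to `ν`, of the pairings of the data on windows `x - K` with vectors of `V_0`. Perturbing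
the contraction gives `D (k+1) ≤ q' D k + O(τ k) C k` with `q' < 1`, and `C (k+1) ≤ (1 + τ k) C k +
O(D k)`. Since `τ` is summable, `C` stays bounded and `D` is summable
(`exists_bound_and_summable_of_coupled`).

The windows are the right ones because `K` contains everything that one step reads in order to
compute on `K` (`reach_indexSet_subset`), and because any finite set falls into `K` after finitely
many such steps (`exists_reach_iterate_subset`). Hence differences of the data over any bounded
distance are summable in `k`. The step functions `x ↦ c_k(⌊M^k x⌋)` are then uniformly Cauchy with a
continuous limit, and a test function, whose translates sum to `1`, leads to the same limit
(`exists_continuous_limit`). -/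

theorem realVec_add {s : ℕ} (α β : Fin s → ℤ) : realVec (α + β) = realVec α + realVec β := by
  ext i; simp [realVec]

theorem realVec_sub {s : ℕ} (α β : Fin s → ℤ) : realVec (α - β) = realVec α - realVec β := by
  ext i; simp [realVec]

theorem finite_realVec_norm_le {s : ℕ} (R : ℝ) : {α : Fin s → ℤ | ‖realVec α‖ ≤ R}.Finite := by
  refine (Set.finite_Icc (fun _ : Fin s => -⌈R⌉) (fun _ => ⌈R⌉)).subset fun α hα => ?_
  have h1 : ∀ i, |(α i : ℝ)| ≤ (⌈R⌉ : ℝ) := fun i =>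
    ((norm_le_pi_norm (realVec α) i).trans hα).trans (Int.le_ceil _)
  exact ⟨fun i => by exact_mod_cast (abs_le.1 (h1 i)).1,
    fun i => by exact_mod_cast (abs_le.1 (h1 i)).2⟩

/-- A compactly supported function vanishes outside some ball. -/
theorem exists_eq_zero_of_lt_norm {s : ℕ} {f : (Fin s → ℝ) → ℝ} (hf : HasCompactSupport f) :
    ∃ R : ℝ, 0 ≤ R ∧ ∀ x, R < ‖x‖ → f x = 0 := by
  obtain ⟨R, hR⟩ := hf.isCompact.isBounded.subset_closedBall 0
  refine ⟨max R 0, le_max_right _ _, fun x hx => ?_⟩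
  by_contra h
  have := hR (subset_tsupport f h)
  rw [mem_closedBall_zero_iff] at this
  exact absurd (this.trans (le_max_left _ _)) (not_le.2 hx)

theorem finite_support_shifts {s : ℕ} {f : (Fin s → ℝ) → ℝ} (hf : HasCompactSupport f)
    (x : Fin s → ℝ) : (Function.support fun α : Fin s → ℤ => f (x - realVec α)).Finite := by
  obtain ⟨R, _, hR⟩ := exists_eq_zero_of_lt_norm hf
  refine (finite_realVec_norm_le (R + ‖x‖)).subset fun α hα => ?_
  have h1 : ‖x - realVec α‖ ≤ R := by
    by_contra h
    exact hα (hR _ (not_le.1 h))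
  have h2 : ‖realVec α‖ ≤ ‖x - realVec α‖ + ‖x‖ := by
    rw [norm_sub_rev]
    simpa using norm_add_le (realVec α - x) x
  exact h2.trans (by linarith)

theorem continuous_tsum_shifts {s : ℕ} {f : (Fin s → ℝ) → ℝ} (hc : Continuous f)
    (hf : HasCompactSupport f) :
    Continuous fun x : Fin s → ℝ => ∑' α : Fin s → ℤ, f (x - realVec α) := by
  obtain ⟨R, _, hR⟩ := exists_eq_zero_of_lt_norm hf
  rw [continuous_iff_continuousAt]
  intro x
  have hfin := finite_realVec_norm_le (s := s) (R + (‖x‖ + 1))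
  have : (fun y : Fin s → ℝ => ∑' α : Fin s → ℤ, f (y - realVec α)) =ᶠ[𝓝 x]
      fun y => ∑ α ∈ hfin.toFinset, f (y - realVec α) := by
    filter_upwards [Metric.ball_mem_nhds x one_pos] with y hy
    refine tsum_eq_sum fun α hα => hR _ ?_
    have hα' : R + (‖x‖ + 1) < ‖realVec α‖ := by simpa using hα
    have h2 : ‖realVec α‖ ≤ ‖y - realVec α‖ + ‖y‖ := by
      rw [norm_sub_rev]
      simpa using norm_add_le (realVec α - y) y
    have h3 : ‖y‖ ≤ ‖x‖ + 1 := by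
      have := norm_add_le (y - x) x
      rw [sub_add_cancel] at this
      rw [mem_ball_iff_norm] at hy
      linarith
    linarith
  refine ContinuousAt.congr ?_ this.symm
  exact (continuous_finsetSum _ fun α _ => by fun_prop).continuousAt

/-- Lattice translates of the half-open unit cube tile `ℝ^s`. -/
theorem integral_eq_integral_cube_tsum {s : ℕ} {h : (Fin s → ℝ) → ℂ} (hc : Continuous h)
    {R : ℝ} (hR : ∀ x, R < ‖x‖ → h x = 0) :
    ∫ x, h x = ∫ x in {x : Fin s → ℝ | ∀ i, x i ∈ Set.Ioc (0 : ℝ) (0 + 1)},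
      ∑' α : Fin s → ℤ, h (x - realVec α) := by
  set Q : Set (Fin s → ℝ) := {x | ∀ i, x i ∈ Set.Ioc (0 : ℝ) (0 + 1)} with hQ
  have hQm : MeasurableSet Q := MeasurableSet.univ_pi' fun i => measurableSet_Ioc
  have hQn : ∀ x ∈ Q, ‖x‖ ≤ 1 := fun x hx => by
    rw [pi_norm_le_iff_of_nonneg zero_le_one]
    intro i
    have := hx i
    rw [Real.norm_eq_abs, abs_le]
    constructor <;> linarith [this.1, this.2]
  have hfin := finite_realVec_norm_le (s := s) (R + 1)
  set F := hfin.toFinset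
  have hint : Integrable h := hc.integrable_of_hasCompactSupport
    (HasCompactSupport.of_support_subset_isCompact (isCompact_closedBall 0 R) fun x hx => by
      rw [mem_closedBall_zero_iff]
      by_contra hlt
      exact hx (hR x (not_le.1 hlt)))
  have h1 : ∫ x in Q, ∑' α : Fin s → ℤ, h (x - realVec α)
      = ∑ α ∈ F, ∫ x in Q, h (x - realVec α) := by
    rw [← integral_finsetSum _ fun α _ => (hint.comp_sub_right (realVec α)).integrableOn]
    refine setIntegral_congr_fun hQm fun x hx => ?_
    refine tsum_eq_sum fun α hα => hR _ ?_
    have hα' : R + 1 < ‖realVec α‖ := by simpa [F] using hα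
    have h2 : ‖realVec α‖ ≤ ‖x - realVec α‖ + ‖x‖ := by
      rw [norm_sub_rev]
      simpa using norm_add_le (realVec α - x) x
    linarith [hQn x hx]
  have h2 : ∀ α : Fin s → ℤ, ∫ x in Q, h (x - realVec α)
      = ∫ x in (fun x => x + realVec α) ⁻¹' Q, h x := fun α => by
    have := (measurePreserving_sub_right (volume : Measure (Fin s → ℝ)) (realVec α))
    rw [← this.setIntegral_preimage_emb (MeasurableEquiv.subRight (realVec α)).measurableEmbedding
      h ((fun x => x + realVec α) ⁻¹' Q)]
    congr 2
    ext x
    simp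
  have hdisj : (F : Set (Fin s → ℤ)).Pairwise
      (Function.onFun Disjoint fun α => (fun x => x + realVec α) ⁻¹' Q) := by
    intro α _ β _ hne
    rw [Function.onFun, Set.disjoint_left]
    intro x hx hy
    apply hne
    ext i
    have h3 := hx i
    have h4 := hy i
    simp only [Pi.add_apply, realVec, Set.mem_Ioc] at h3 h4
    have h5 : (α i : ℝ) < β i + 1 := by linarith [h3.2, h4.1]
    have h6 : (β i : ℝ) < α i + 1 := by linarith [h4.2, h3.1]
    have h7 : α i < β i + 1 := by exact_mod_cast h5
    have h8 : β i < α i + 1 := by exact_mod_cast h6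
    omega
  rw [h1, Finset.sum_congr rfl fun α _ => h2 α, ← integral_biUnion_finset F
    (fun α _ => (measurable_add_const (realVec α)) hQm) hdisj fun α _ => hint.integrableOn]
  symm
  refine setIntegral_eq_integral_of_forall_compl_eq_zero fun x hx => hR x ?_
  by_contra hle
  apply hx
  have hle := not_lt.1 hle
  rw [Set.mem_iUnion₂]
  -- Shifting by `1 - ⌈x i⌉` moves each coordinate into `(0, 1]`, matching the half-open cube.
  refine ⟨fun i => 1 - ⌈x i⌉, ?_, fun i => ?_⟩
  · simp only [F, Set.Finite.mem_toFinset, Set.mem_ofPred_eq]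
    have h3 : ‖x + realVec (fun i => 1 - ⌈x i⌉)‖ ≤ 1 := by
      apply hQn
      intro i
      simp only [Pi.add_apply, realVec, Set.mem_Ioc, Int.cast_sub, Int.cast_one]
      constructor <;> linarith [Int.le_ceil (x i), Int.ceil_lt_add_one (x i)]
    have h4 := norm_sub_le (x + realVec (fun i => 1 - ⌈x i⌉)) x
    rw [add_sub_cancel_left] at h4
    linarith
  · simp only [Pi.add_apply, realVec, Set.mem_Ioc, Int.cast_sub, Int.cast_one]
    constructor <;> linarith [Int.le_ceil (x i), Int.ceil_lt_add_one (x i)]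

theorem mFourier_neg_mk {s : ℕ} (n : Fin s → ℤ) (x : Fin s → ℝ) :
    UnitAddTorus.mFourier (-n) (fun i => (x i : UnitAddCircle))
      = Complex.exp (-(2 * (Real.pi : ℂ) * Complex.I * ((x ⬝ᵥ realVec n : ℝ) : ℂ))) := by
  simp only [UnitAddTorus.mFourier, ContinuousMap.coe_mk, fourier_coe_apply, dotProduct, realVec]
  rw [← Complex.exp_sum]
  congr 1
  push_cast
  rw [Finset.mul_sum, ← Finset.sum_neg_distrib]
  refine Finset.sum_congr rfl fun i _ => ?_
  simp
  ring

theorem tsum_shifts_add_realVec {s : ℕ} (f : (Fin s → ℝ) → ℝ) (x : Fin s → ℝ)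
    (β : Fin s → ℤ) :
    ∑' α : Fin s → ℤ, f (x + realVec β - realVec α) = ∑' α : Fin s → ℤ, f (x - realVec α) := by
  rw [← (Equiv.addRight β).tsum_eq fun α : Fin s → ℤ => f (x + realVec β - realVec α)]
  refine tsum_congr fun α => ?_
  simp only [Equiv.coe_addRight, realVec_add]
  congr 1
  abel

/-- The integer translates of a test function form a partition of unity. -/
theorem IsTestFunction.tsum_shifts_eq_one {s : ℕ} {f : (Fin s → ℝ) → ℝ} (hf : IsTestFunction f)
    (x : Fin s → ℝ) : ∑' α : Fin s → ℤ, f (x - realVec α) = 1 := by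
  -- The periodization is continuous and descends to the torus, where its Fourier coefficients are
  -- the values of the Fourier transform of `f` on the lattice. Only the zeroth survives, so the
  -- Fourier series is finite and represents `F` at every point.
  set F : (Fin s → ℝ) → ℂ := fun x => ((∑' α : Fin s → ℤ, f (x - realVec α) : ℝ) : ℂ) with hF
  have hFc : Continuous F := Complex.continuous_ofReal.comp
    (continuous_tsum_shifts hf.continuous hf.hasCompactSupport)
  let π : (Fin s → ℝ) → UnitAddTorus (Fin s) := fun x i => (x i : UnitAddCircle)
  have hπ : IsOpenQuotientMap π :=
    IsOpenQuotientMap.piMap fun _ : Fin s => QuotientAddGroup.isOpenQuotientMap_mk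
  have hfac : ∀ y z : Fin s → ℝ, π y = π z → F y = F z := by
    intro y z h
    have h1 : ∀ i, ∃ n : ℤ, z i - y i = n := fun i => by
      have h2 := congrFun h i
      rw [QuotientAddGroup.eq, AddSubgroup.mem_zmultiples_iff] at h2
      obtain ⟨n, hn⟩ := h2
      exact ⟨n, by rw [zsmul_one] at hn; rw [hn]; ring⟩
    choose n hn using h1
    have hz : z = y + realVec n := by
      ext i
      simp only [Pi.add_apply, realVec, ← hn i]
      ring
    rw [hz]
    simp only [hF, tsum_shifts_add_realVec]
  let Fbar : C(UnitAddTorus (Fin s), ℂ) :=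
    ⟨fun t => F (Function.surjInv hπ.surjective t), by
      rw [hπ.isQuotientMap.continuous_iff]
      convert hFc using 1
      ext y
      exact hfac _ _ (Function.surjInv_eq hπ.surjective (π y))⟩
  have hFbar : ∀ y, Fbar (π y) = F y := fun y =>
    hfac _ _ (Function.surjInv_eq hπ.surjective (π y))
  obtain ⟨R, _, hR⟩ := exists_eq_zero_of_lt_norm hf.hasCompactSupport
  have hcoeff : ∀ n : Fin s → ℤ,
      UnitAddTorus.mFourierCoeff Fbar n = fourier f (realVec n) := by
    intro n
    rw [UnitAddTorus.mFourierCoeff_eq_integral _ n 0, fourier,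
      integral_eq_integral_cube_tsum (R := R) (h := fun x =>
        Complex.exp (-(2 * (Real.pi : ℂ) * Complex.I * ((x ⬝ᵥ realVec n : ℝ) : ℂ))) * (f x : ℂ))
        (by
          have := hf.continuous
          have h2 : Continuous fun x : Fin s → ℝ => x ⬝ᵥ realVec n := by
            unfold dotProduct; fun_prop
          fun_prop) (fun x hx => by simp [hR x hx])]
    congr 1
    ext y
    change UnitAddTorus.mFourier (-n) (fun i => (y i : UnitAddCircle)) • Fbar (π y) = _
    rw [hFbar, smul_eq_mul, hF]
    simp only
    rw [Complex.ofReal_tsum, ← tsum_mul_left]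
    refine tsum_congr fun α => ?_
    rw [← mFourier_neg_mk]
    congr 2
    ext i
    simp only [Pi.sub_apply, realVec]
    rw [AddCircle.coe_sub]
    have : ((α i : ℝ) : UnitAddCircle) = 0 := by
      rw [AddCircle.coe_eq_zero_iff]
      exact ⟨α i, by simp⟩
    rw [this, sub_zero]
  have hcoeff' : ∀ n : Fin s → ℤ, n ≠ 0 → UnitAddTorus.mFourierCoeff Fbar n = 0 := fun n hn => by
    rw [hcoeff, hf.fourier_lattice n hn]
  have hcoeff0 : UnitAddTorus.mFourierCoeff Fbar 0 = 1 := by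
    rw [hcoeff]
    have : realVec (0 : Fin s → ℤ) = 0 := by ext; simp [realVec]
    rw [this, hf.fourier_zero]
  have hsum : Summable (UnitAddTorus.mFourierCoeff Fbar) :=
    summable_of_ne_finset_zero (s := {0}) fun n hn => hcoeff' n (by simpa using hn)
  have h1 := (UnitAddTorus.hasSum_mFourier_series_apply_of_summable hsum (π x)).tsum_eq
  rw [tsum_eq_single 0 fun n hn => by rw [hcoeff' n hn, zero_smul], hcoeff0, hFbar,
    UnitAddTorus.mFourier_zero] at h1
  simp only [hF, ContinuousMap.one_apply, smul_eq_mul, mul_one] at h1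
  exact_mod_cast h1.symm

/-! ### Coset sums of a mask -/

/-- The cube `{0, …, N}^s` as a finite set. -/
noncomputable def cubeFinset (s N : ℕ) : Finset (Fin s → ℤ) := Finset.Icc 0 fun _ => (N : ℤ)

theorem mem_cubeFinset {s N : ℕ} {α : Fin s → ℤ} : α ∈ cubeFinset s N ↔ α ∈ cube s N := by
  simp only [cubeFinset, Finset.mem_Icc, cube, Set.mem_ofPred_eq, Pi.le_def, Pi.zero_apply]
  exact forall_and.symm

theorem Mask.SupportedIn.eq_zero {s N : ℕ} {a : Mask s} (ha : a.SupportedIn N)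
    {α : Fin s → ℤ} (hα : α ∉ cubeFinset s N) : a α = 0 :=
  ha α (mt mem_cubeFinset.2 hα)

theorem mulVec_intMat_injective {s : ℕ} {M : Matrix (Fin s) (Fin s) ℤ} (hM : M.det ≠ 0) :
    Function.Injective fun x : Fin s → ℤ => M *ᵥ x :=
  Matrix.mulVec_injective_of_det_ne_zero hM

/-- The sublattice `M ℤ^s`. -/
def imageLattice {s : ℕ} (M : Matrix (Fin s) (Fin s) ℤ) : Submodule ℤ (Fin s → ℤ) :=
  LinearMap.range M.mulVecLin

theorem mk_eq_zero_iff {s : ℕ} {M : Matrix (Fin s) (Fin s) ℤ} {x : Fin s → ℤ} :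
    (imageLattice M).mkQ x = 0 ↔ ∃ y, M *ᵥ y = x := by
  rw [Submodule.mkQ_apply, Submodule.Quotient.mk_eq_zero, imageLattice, LinearMap.mem_range]
  rfl

theorem card_quotient_imageLattice {s : ℕ} {M : Matrix (Fin s) (Fin s) ℤ} (hM : M.det ≠ 0) :
    Nat.card ((Fin s → ℤ) ⧸ imageLattice M) = M.det.natAbs := by
  have hinj : Function.Injective M.mulVecLin := mulVec_intMat_injective hM
  rw [← Submodule.natAbs_det_equiv (imageLattice M)
    (LinearEquiv.ofInjective M.mulVecLin hinj)]
  congr 1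
  exact LinearMap.det_toLin' M

theorem symbol_eq_sum {s N : ℕ} {b : Mask s} (hb : b.SupportedIn N) (z : Fin s → ℂ) :
    symbol b z = ∑ α ∈ cubeFinset s N, (b α : ℂ) * ∏ j, z j ^ α j :=
  tsum_eq_sum fun α hα => by rw [hb.eq_zero hα]; simp

theorem norm_eq_one_of_mem_Xi {s : ℕ} {M : Matrix (Fin s) (Fin s) ℤ} {z : Fin s → ℂ}
    (hz : z ∈ Xi M) (j : Fin s) : ‖z j‖ = 1 := by
  obtain ⟨ξ, rfl⟩ := hz
  simp only
  rw [Complex.norm_exp]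
  simp

/-- A real `sSup` dominates its set only if the set is bounded above. Points of `Xi M` have
unimodular coordinates, so the sum of the `|b α|` is such a bound. -/
theorem norm_symbol_le_sumRuleDefect {s N : ℕ} {M : Matrix (Fin s) (Fin s) ℤ} {b : Mask s}
    (hb : b.SupportedIn N) {z : Fin s → ℂ} (hz : z ∈ Xi M \ {1}) :
    ‖symbol b z‖ ≤ sumRuleDefect M b := by
  refine le_csSup ⟨∑ α ∈ cubeFinset s N, |b α|, ?_⟩ (Set.mem_image_of_mem _ hz)
  rintro _ ⟨w, hw, rfl⟩
  simp only [symbol_eq_sum hb]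
  refine (norm_sum_le _ _).trans (Finset.sum_le_sum fun α _ => le_of_eq ?_)
  simp [norm_eq_one_of_mem_Xi hw.1]

/-- The values on the standard basis of a character of `ℤ^s / M ℤ^s`. -/
noncomputable def charPoint {s : ℕ} {M : Matrix (Fin s) (Fin s) ℤ}
    (ψ : AddChar ((Fin s → ℤ) ⧸ imageLattice M) ℂ) : Fin s → ℂ :=
  fun j => ψ ((imageLattice M).mkQ (Pi.single j 1))

theorem char_mk_eq_prod {s : ℕ} {M : Matrix (Fin s) (Fin s) ℤ}
    (ψ : AddChar ((Fin s → ℤ) ⧸ imageLattice M) ℂ) (x : Fin s → ℤ) :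
    ψ ((imageLattice M).mkQ x) = ∏ j, charPoint ψ j ^ x j := by
  have hx : x = ∑ j, x j • (Pi.single j 1 : Fin s → ℤ) := by
    ext i
    simp [Finset.sum_apply, Pi.single_apply]
  conv_lhs => rw [hx, map_sum]
  change ψ.toMonoidHom (Multiplicative.ofAdd (∑ j : Fin s, _)) = _
  rw [ofAdd_sum, map_prod]
  refine Finset.prod_congr rfl fun j _ => ?_
  rw [map_zsmul]
  exact AddChar.map_zsmul_eq_zpow _ _ _

theorem realMat_det {s : ℕ} (M : Matrix (Fin s) (Fin s) ℤ) :
    (realMat M).det = (M.det : ℝ) := by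
  have := (Int.castRingHom ℝ).map_det M
  simpa [realMat] using this.symm

theorem isUnit_realMat_det {s : ℕ} {M : Matrix (Fin s) (Fin s) ℤ} (hM : M.det ≠ 0) :
    IsUnit (realMat M).det := by
  rw [realMat_det, isUnit_iff_ne_zero]
  exact_mod_cast hM

/-- The quotient is finite, so the character values are `exp(2πi t_j)` with real `t_j`. Triviality
on the columns of `M` says that `ξ = Mᵀ t` is integral, whence `t = M^{-T} ξ`. -/
theorem charPoint_mem_Xi {s : ℕ} {M : Matrix (Fin s) (Fin s) ℤ} (hM : M.det ≠ 0)
    (ψ : AddChar ((Fin s → ℤ) ⧸ imageLattice M) ℂ) : charPoint ψ ∈ Xi M := by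
  have : Finite ((Fin s → ℤ) ⧸ imageLattice M) := Nat.finite_of_card_ne_zero (by
    rw [card_quotient_imageLattice hM]
    exact Int.natAbs_ne_zero.2 hM)
  have h1 : ∀ j, ∃ t : ℝ, charPoint ψ j = Complex.exp (2 * Real.pi * Complex.I * t) := fun j => by
    obtain ⟨θ, hθ⟩ := (Complex.norm_eq_one_iff _).1
      (AddChar.norm_apply ψ ((imageLattice M).mkQ (Pi.single j 1)))
    refine ⟨θ / (2 * Real.pi), ?_⟩
    rw [charPoint, ← hθ]
    congr 1
    have : (Real.pi : ℂ) ≠ 0 := by exact_mod_cast Real.pi_ne_zero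
    push_cast
    field_simp
  choose t ht using h1
  have h2 : ∀ i, ∃ n : ℤ, ∑ j, (M j i : ℝ) * t j = n := fun i => by
    have h3 : ψ ((imageLattice M).mkQ (M *ᵥ Pi.single i 1)) = 1 := by
      rw [mk_eq_zero_iff.2 ⟨_, rfl⟩, AddChar.map_zero_eq_one]
    rw [char_mk_eq_prod] at h3
    simp only [Matrix.mulVec_single_one, Matrix.col_apply, ht, ← Complex.exp_int_mul] at h3
    rw [← Complex.exp_sum, Complex.exp_eq_one_iff] at h3
    obtain ⟨n, hn⟩ := h3
    refine ⟨n, ?_⟩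
    have h4 : (2 * Real.pi * Complex.I : ℂ) * ∑ j, (M j i : ℂ) * t j
        = (2 * Real.pi * Complex.I) * n := by
      rw [Finset.mul_sum, mul_comm _ (n : ℂ), ← hn]
      exact Finset.sum_congr rfl fun j _ => by ring
    have h5 := mul_left_cancel₀ Complex.two_pi_I_ne_zero h4
    exact_mod_cast h5
  choose ξ hξ using h2
  refine ⟨ξ, ?_⟩
  have hT : (realMat M)ᵀ *ᵥ t = realVec ξ := by
    ext i
    simp only [Matrix.mulVec, dotProduct, Matrix.transpose_apply, realMat, Matrix.map_apply,
      realVec, hξ]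
  have hT' : (realMat M)ᵀ⁻¹ *ᵥ realVec ξ = t := by
    rw [← hT, Matrix.mulVec_mulVec, Matrix.nonsing_inv_mul _ (by
      rw [Matrix.det_transpose]; exact isUnit_realMat_det hM), Matrix.one_mulVec]
  ext j
  simp only
  rw [hT', ht]

-- `S_b 1` at `y` is the sum of the mask over the coset of `y`. The indicator of that coset, summed
-- over the fixed cube, is the form in which characters can be inserted and limits of masks taken.
open Classical in
theorem subdivision_one_eq_sum {s N : ℕ} {M : Matrix (Fin s) (Fin s) ℤ} (hM : M.det ≠ 0)
    {b : Mask s} (hb : b.SupportedIn N) (y : Fin s → ℤ) :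
    subdivision M b (fun _ => 1) y
      = ∑ α ∈ cubeFinset s N, if (imageLattice M).mkQ (α - y) = 0 then b α else 0 := by
  have hinj : Function.Injective fun β : Fin s → ℤ => y - M *ᵥ β :=
    sub_right_injective.comp (mulVec_intMat_injective hM)
  have h1 := hinj.tsum_eq
    (f := fun α => if (imageLattice M).mkQ (α - y) = 0 then b α else 0) (fun α hα => by
      obtain ⟨x, hx⟩ := mk_eq_zero_iff.1 (not_not.1 fun h => hα (if_neg h))
      refine ⟨-x, ?_⟩
      simp [Matrix.mulVec_neg, hx])
  have h2 : ∑' α, (if (imageLattice M).mkQ (α - y) = 0 then b α else 0)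
      = ∑ α ∈ cubeFinset s N, if (imageLattice M).mkQ (α - y) = 0 then b α else 0 :=
    tsum_eq_sum fun α hα => by rw [hb.eq_zero hα, ite_self]
  rw [← h2, ← h1, subdivision]
  refine tsum_congr fun β => ?_
  rw [mul_one, if_pos]
  rw [mk_eq_zero_iff]
  exact ⟨-β, by simp [Matrix.mulVec_neg]⟩

/-- The coset sums of a mask differ from `1` by at most the defects in the sum rules. -/
theorem abs_subdivision_one_sub_one_le {s N : ℕ} {M : Matrix (Fin s) (Fin s) ℤ}
    (hM : M.det ≠ 0) {b : Mask s} (hb : b.SupportedIn N) (y : Fin s → ℤ) :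
    |subdivision M b (fun _ => 1) y - 1| ≤ normalizationDefect M b + sumRuleDefect M b := by
  classical
  set A := (Fin s → ℤ) ⧸ imageLattice M
  have hcard := card_quotient_imageLattice hM
  have hne : Nat.card A ≠ 0 := by
    rw [hcard]
    exact Int.natAbs_ne_zero.2 hM
  have : Finite A := Nat.finite_of_card_ne_zero hne
  let _ : Fintype A := Fintype.ofFinite A
  -- Fourier inversion on the finite group `A`: summing over characters detects whether `α - y` lies
  -- in `M ℤ^s`.
  have hsum : (Nat.card A : ℂ) * (subdivision M b (fun _ => 1) y : ℂ)
      = ∑ ψ : AddChar A ℂ, ψ ((imageLattice M).mkQ (-y)) * symbol b (charPoint ψ) := by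
    simp only [symbol_eq_sum hb, Finset.mul_sum]
    rw [Finset.sum_comm, subdivision_one_eq_sum hM hb, Complex.ofReal_sum, Finset.mul_sum]
    refine Finset.sum_congr rfl fun α _ => ?_
    have h1 : ∀ ψ : AddChar A ℂ, ψ ((imageLattice M).mkQ (-y))
        * ((b α : ℂ) * ∏ j, charPoint ψ j ^ α j)
        = (b α : ℂ) * ψ ((imageLattice M).mkQ (α - y)) := fun ψ => by
      rw [← char_mk_eq_prod, sub_eq_add_neg, map_add _ α, AddChar.map_add_eq_mul]
      ring
    rw [Finset.sum_congr rfl fun ψ _ => h1 ψ, ← Finset.mul_sum, AddChar.sum_apply_eq_ite,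
      Nat.card_eq_fintype_card]
    split_ifs <;> simp [mul_comm]
  have h0 : charPoint (0 : AddChar A ℂ) = 1 := by
    ext j
    simp [charPoint]
  rw [← Finset.add_sum_erase _ _ (Finset.mem_univ 0), h0] at hsum
  have hδ : 0 ≤ sumRuleDefect M b := by
    refine Real.sSup_nonneg ?_
    rintro _ ⟨z, _, rfl⟩
    exact norm_nonneg _
  have hbound : ‖∑ ψ ∈ (Finset.univ : Finset (AddChar A ℂ)).erase 0,
      ψ ((imageLattice M).mkQ (-y)) * symbol b (charPoint ψ)‖
      ≤ Nat.card A * sumRuleDefect M b := by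
    refine (norm_sum_le_of_le _ (f := fun ψ : AddChar A ℂ =>
      ψ ((imageLattice M).mkQ (-y)) * symbol b (charPoint ψ))
      (n := fun _ => sumRuleDefect M b) fun ψ hψ => ?_).trans ?_
    · rw [norm_mul, AddChar.norm_apply, one_mul]
      refine norm_symbol_le_sumRuleDefect hb ⟨charPoint_mem_Xi hM ψ, fun h => ?_⟩
      refine Finset.ne_of_mem_erase hψ ?_
      ext x
      obtain ⟨x, rfl⟩ := (imageLattice M).mkQ_surjective x
      rw [char_mk_eq_prod, Set.mem_singleton_iff.1 h]
      simp
    · rw [Finset.sum_const, nsmul_eq_mul]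
      gcongr
      refine (Finset.card_le_univ _).trans ?_
      rw [AddChar.card_eq, Nat.card_eq_fintype_card]
  have hm : (1 : ℝ) ≤ Nat.card A := by exact_mod_cast Nat.one_le_iff_ne_zero.2 hne
  have hdet : ((|M.det| : ℤ) : ℂ) = (Nat.card A : ℂ) := by
    rw [hcard, Int.abs_eq_natAbs, Int.cast_natCast]
  have hμ : ‖symbol b 1 - (Nat.card A : ℂ)‖ = normalizationDefect M b := by
    rw [normalizationDefect, hdet]
  have hμ0 : 0 ≤ normalizationDefect M b := norm_nonneg _
  -- The trivial character contributes the normalization defect, each of the fewer than `Nat.card A`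
  -- others at most the sum rule defect.
  have key : (Nat.card A : ℝ) * |subdivision M b (fun _ => 1) y - 1|
      ≤ Nat.card A * (normalizationDefect M b + sumRuleDefect M b) := by
    have h2 : (Nat.card A : ℝ) * |subdivision M b (fun _ => 1) y - 1|
        = ‖(Nat.card A : ℂ) * (subdivision M b (fun _ => 1) y : ℂ) - Nat.card A‖ := by
      rw [← mul_sub_one, norm_mul, Complex.norm_natCast, ← Complex.ofReal_one,
        ← Complex.ofReal_sub, Complex.norm_real, Real.norm_eq_abs]
    rw [h2, hsum, AddChar.zero_apply, one_mul, add_sub_right_comm]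
    refine (norm_add_le _ _).trans ?_
    rw [hμ, mul_add]
    exact add_le_add (le_mul_of_one_le_left hμ0 hm) hbound
  exact le_of_mul_le_mul_left key (by linarith)

/-! ### The attractor absorbs finite sets of lattice points -/

theorem realVec_mulVec {s : ℕ} (M : Matrix (Fin s) (Fin s) ℤ) (α : Fin s → ℤ) :
    realVec (M *ᵥ α) = realMat M *ᵥ realVec α := by
  ext i
  simp [realVec, realMat, Matrix.mulVec, dotProduct]

theorem inv_mulVec_realVec_mulVec {s : ℕ} {M : Matrix (Fin s) (Fin s) ℤ} (hM : M.det ≠ 0)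
    (α : Fin s → ℤ) : (realMat M)⁻¹ *ᵥ realVec (M *ᵥ α) = realVec α := by
  rw [realVec_mulVec, Matrix.mulVec_mulVec, Matrix.nonsing_inv_mul _ (isUnit_realMat_det hM),
    Matrix.one_mulVec]

/-- The lattice points `α = M⁻¹(p + q - ε)` with `p ∈ P`, `q ∈ {0, …, N}^s` and `ε ∈ E`. -/
def reach {s : ℕ} (M : Matrix (Fin s) (Fin s) ℤ) (N : ℕ) (E : Finset (Fin s → ℤ))
    (P : Set (Fin s → ℤ)) : Set (Fin s → ℤ) :=
  {α | ∃ p ∈ P, ∃ q ∈ cube s N, ∃ ε ∈ E, M *ᵥ α = p + q - ε}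

theorem mem_indexSet {s : ℕ} {M : Matrix (Fin s) (Fin s) ℤ} {hM : IsDilation M}
    {G : Finset (Fin s → ℤ)} {α : Fin s → ℤ} :
    α ∈ indexSet hM G ↔ ∃ g : ℕ → Fin s → ℤ, (∀ r, g r ∈ G) ∧
      HasSum (fun r => (realMat M)⁻¹ ^ (r + 1) *ᵥ realVec (g r)) (realVec α) := by
  rw [indexSet, Set.Finite.mem_toFinset]
  rfl

theorem realVec_of_mulVec_eq {s : ℕ} {M : Matrix (Fin s) (Fin s) ℤ} (hM : M.det ≠ 0)
    {α p q ε : Fin s → ℤ} (h : M *ᵥ α = p + q - ε) :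
    realVec α = (realMat M)⁻¹ *ᵥ realVec (q - ε) + (realMat M)⁻¹ *ᵥ realVec p := by
  rw [← inv_mulVec_realVec_mulVec hM α, h, ← Matrix.mulVec_add, ← realVec_add]
  congr 2
  abel

/-- If `Mα = p + q - ε`, then prefixing the digit `q - ε ∈ G` to an expansion of `p` gives an
expansion of `α`. -/
theorem reach_indexSet_subset {s N : ℕ} {M : Matrix (Fin s) (Fin s) ℤ} (hM : IsDilation M)
    {E G : Finset (Fin s → ℤ)} (hG : ∀ α ∈ cube s N, ∀ ε ∈ E, α - ε ∈ G) :
    reach M N E (indexSet hM G) ⊆ indexSet hM G := by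
  rintro α ⟨p, hp, q, hq, ε, hε, h⟩
  rw [Finset.mem_coe, mem_indexSet] at hp ⊢
  obtain ⟨g, hg, hsum⟩ := hp
  refine ⟨fun r => Nat.casesOn r (q - ε) g, fun r => ?_, ?_⟩
  · cases r with
    | zero => exact hG q hq ε hε
    | succ r => exact hg r
  · rw [← hasSum_nat_add_iff' 1]
    simp only [Finset.range_one, Finset.sum_singleton, zero_add, pow_one]
    rw [realVec_of_mulVec_eq hM.1 h]
    change HasSum _ (_ + _ - (realMat M)⁻¹ *ᵥ realVec (q - ε))
    rw [add_sub_cancel_left]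
    have h2 := hsum.mapL (LinearMap.toContinuousLinearMap ((realMat M)⁻¹).mulVecLin)
    simpa [pow_succ' _ (_ + 1)] using h2

/-- Each step back contributes one digit and one factor `M⁻¹`. Digits of index at least `n` are
arbitrary fillers, which is why `G` has to be nonempty. -/
theorem exists_expansion_of_mem_reach_iterate {s N : ℕ} {M : Matrix (Fin s) (Fin s) ℤ}
    (hM : M.det ≠ 0) {E G : Finset (Fin s → ℤ)} (hG : ∀ α ∈ cube s N, ∀ ε ∈ E, α - ε ∈ G)
    (hGne : G.Nonempty) (P : Set (Fin s → ℤ)) (n : ℕ) {α : Fin s → ℤ}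
    (hα : α ∈ (reach M N E)^[n] P) :
    ∃ p ∈ P, ∃ g : ℕ → Fin s → ℤ, (∀ r, g r ∈ G) ∧
      realVec α = (realMat M)⁻¹ ^ n *ᵥ realVec p
        + ∑ r ∈ Finset.range n, (realMat M)⁻¹ ^ (r + 1) *ᵥ realVec (g r) := by
  induction n generalizing α with
  | zero => exact ⟨α, hα, fun _ => hGne.choose, fun _ => hGne.choose_spec, by simp⟩
  | succ n ih =>
    rw [Function.iterate_succ_apply'] at hα
    obtain ⟨p', hp', q, hq, ε, hε, h⟩ := hα
    obtain ⟨p, hp, g, hg, hexp⟩ := ih hp'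
    refine ⟨p, hp, fun r => Nat.casesOn r (q - ε) g, fun r => ?_, ?_⟩
    · cases r with
      | zero => exact hG q hq ε hε
      | succ r => exact hg r
    · rw [realVec_of_mulVec_eq hM h, Finset.sum_range_succ', hexp]
      simp only [Matrix.mulVec_add, Matrix.mulVec_sum, zero_add, pow_one, Matrix.mulVec_mulVec,
        ← pow_succ']
      exact (add_comm _ _).trans (add_assoc _ _ _)

theorem isClosed_realVec_image {s : ℕ} (S : Set (Fin s → ℤ)) : IsClosed (realVec '' S) := by
  refine Metric.isClosed_of_pairwise_le_dist one_pos ?_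
  rintro _ ⟨α, _, rfl⟩ _ ⟨β, _, rfl⟩ hne
  have hne' : α ≠ β := fun h => hne (h ▸ rfl)
  obtain ⟨i, hi⟩ := Function.ne_iff.1 hne'
  have h1 : (1 : ℤ) ≤ |α i - β i| := Int.one_le_abs (sub_ne_zero.2 hi)
  have h2 := dist_le_pi_dist (realVec α) (realVec β) i
  refine le_trans ?_ h2
  rw [Real.dist_eq, realVec, realVec]
  exact_mod_cast h1

/-- The attractor is the image of the compact space of digit sequences under a uniformly convergent
series of continuous maps. -/
theorem isCompact_attractor {s : ℕ} {M : Matrix (Fin s) (Fin s) ℤ} (hM : IsDilation M)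
    (G : Finset (Fin s → ℤ)) :
    IsCompact {x : Fin s → ℝ | ∃ g : ℕ → Fin s → ℤ, (∀ r, g r ∈ G) ∧
      HasSum (fun r => (realMat M)⁻¹ ^ (r + 1) *ᵥ realVec (g r)) x} := by
  obtain ⟨u, hu, hub⟩ := summable_norm_inv_pow_mulVec hM
  obtain ⟨C, hC⟩ : ∃ C : ℝ, ∀ g ∈ G, ‖realVec g‖ ≤ C :=
    ⟨∑ g ∈ G, ‖realVec g‖, fun g hg =>
      Finset.single_le_sum (f := fun g => ‖realVec g‖) (fun _ _ => norm_nonneg _) hg⟩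
  have hb : ∀ (r : ℕ) (g : ℕ → G),
      ‖(realMat M)⁻¹ ^ (r + 1) *ᵥ realVec (g r : Fin s → ℤ)‖ ≤ |u r| * C := fun r g =>
    (hub r _).trans ((mul_le_mul_of_nonneg_right (le_abs_self _) (norm_nonneg _)).trans
      (mul_le_mul_of_nonneg_left (hC _ (g r).2) (abs_nonneg _)))
  have hs : Summable fun r => |u r| * C := hu.abs.mul_right C
  have hcont : Continuous fun g : ℕ → G =>
      ∑' r, (realMat M)⁻¹ ^ (r + 1) *ᵥ realVec (g r : Fin s → ℤ) := by
    refine continuous_tsum (fun r => ?_) hs hb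
    have h1 : Continuous (fun α : G => (realMat M)⁻¹ ^ (r + 1) *ᵥ realVec (α : Fin s → ℤ)) :=
      continuous_of_discreteTopology
    exact h1.comp (continuous_apply r)
  convert isCompact_range hcont using 1
  ext x
  constructor
  · rintro ⟨g, hg, hx⟩
    exact ⟨fun r => ⟨g r, hg r⟩, hx.tsum_eq⟩
  · rintro ⟨g, rfl⟩
    exact ⟨fun r => g r, fun r => (g r).2, (Summable.of_norm_bounded hs fun r => hb r g).hasSum⟩

/-- After `n` steps a point differs from a point of the attractor by `M^{-n} p` and the tail of a
digit series, both tending to zero uniformly. Lattice points outside `K` form a closed set disjoint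
from the compact attractor, hence keep a positive distance from it. -/
theorem exists_reach_iterate_subset {s N : ℕ} {M : Matrix (Fin s) (Fin s) ℤ}
    (hM : IsDilation M) {E G : Finset (Fin s → ℤ)}
    (hG : ∀ α ∈ cube s N, ∀ ε ∈ E, α - ε ∈ G) (hGne : G.Nonempty)
    {P : Set (Fin s → ℤ)} (hP : P.Finite) :
    ∃ n, (reach M N E)^[n] P ⊆ indexSet hM G := by
  have hX := isCompact_attractor hM G
  obtain ⟨u, hu, hub⟩ := summable_norm_inv_pow_mulVec hM
  obtain ⟨C, hC⟩ : ∃ C : ℝ, ∀ g ∈ G, ‖realVec g‖ ≤ C :=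
    ⟨∑ g ∈ G, ‖realVec g‖, fun g hg =>
      Finset.single_le_sum (f := fun g => ‖realVec g‖) (fun _ _ => norm_nonneg _) hg⟩
  obtain ⟨R, hR⟩ : ∃ R : ℝ, ∀ p ∈ P, ‖realVec p‖ ≤ R :=
    ⟨∑ g ∈ hP.toFinset, ‖realVec g‖, fun g hg =>
      Finset.single_le_sum (f := fun g => ‖realVec g‖) (fun _ _ => norm_nonneg _)
        (hP.mem_toFinset.2 hg)⟩
  have hs : Summable fun r => |u r| * C := hu.abs.mul_right C
  obtain ⟨r, hr0, hr⟩ := Metric.exists_pos_forall_lt_edist hX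
    (isClosed_realVec_image (indexSet hM G : Set (Fin s → ℤ))ᶜ) (by
      rw [Set.disjoint_left]
      rintro _ ⟨g, hg, hx⟩ ⟨α, hα, rfl⟩
      exact hα (Finset.mem_coe.2 (mem_indexSet.2 ⟨g, hg, hx⟩)))
  have hlim : Tendsto (fun m => |u m| * R + ∑' k, |u (k + (m + 1))| * C) atTop (𝓝 0) := by
    have h1 := (hu.abs.tendsto_atTop_zero.mul_const R)
    have h2 := (tendsto_sum_nat_add fun r => |u r| * C).comp (tendsto_add_atTop_nat 1)
    simpa using h1.add h2
  obtain ⟨m, hm⟩ := (hlim.eventually (gt_mem_nhds (NNReal.coe_pos.2 hr0))).exists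
  refine ⟨m + 1, fun α hα => ?_⟩
  by_contra hK
  obtain ⟨p, hp, g, hg, hexp⟩ :=
    exists_expansion_of_mem_reach_iterate hM.1 hG hGne P (m + 1) hα
  have hb : ∀ r, ‖(realMat M)⁻¹ ^ (r + 1) *ᵥ realVec (g r)‖ ≤ |u r| * C := fun r =>
    (hub r _).trans ((mul_le_mul_of_nonneg_right (le_abs_self _) (norm_nonneg _)).trans
      (mul_le_mul_of_nonneg_left (hC _ (hg r)) (abs_nonneg _)))
  have hgs := Summable.of_norm_bounded hs hb
  have h3 := hr _ ⟨g, hg, hgs.hasSum⟩ _ ⟨α, hK, rfl⟩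
  have h4 : dist (∑' r, (realMat M)⁻¹ ^ (r + 1) *ᵥ realVec (g r)) (realVec α)
      ≤ |u m| * R + ∑' k, |u (k + (m + 1))| * C := by
    rw [dist_eq_norm, hexp, ← hgs.sum_add_tsum_nat_add (m + 1), add_comm (_ *ᵥ realVec p),
      add_sub_add_left_eq_sub]
    refine (norm_sub_le _ _).trans ?_
    rw [add_comm]
    refine add_le_add ((hub m _).trans ?_)
      (tsum_of_norm_bounded ((summable_nat_add_iff (m + 1)).2 hs).hasSum fun k => hb _)
    exact (mul_le_mul_of_nonneg_right (le_abs_self _) (norm_nonneg _)).trans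
      (mul_le_mul_of_nonneg_left (hR _ hp) (abs_nonneg _))
  rw [edist_dist, ← ENNReal.ofReal_coe_nnreal, ENNReal.ofReal_lt_ofReal_iff_of_nonneg
    (NNReal.coe_nonneg r)] at h3
  linarith

/-! ### Adapted norms -/

section AdaptedNorm

variable {V : Type*} [NormedAddCommGroup V] [NormedSpace ℝ V]

theorem norm_list_prod_le_pow {𝓜 : Set (V →L[ℝ] V)} {B : ℝ} (hB1 : 1 ≤ B)
    (hB : ∀ L ∈ 𝓜, ‖L‖ ≤ B) (l : List (V →L[ℝ] V)) (hl : ∀ L ∈ l, L ∈ 𝓜) :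
    ‖l.prod‖ ≤ B ^ l.length := by
  induction l with
  | nil => exact ContinuousLinearMap.norm_id_le
  | cons L l ih =>
    rw [List.prod_cons, List.length_cons, pow_succ']
    refine (norm_mul_le _ _).trans (mul_le_mul (hB L (hl L (by simp))) (ih fun L hL =>
      hl L (List.mem_cons_of_mem _ hL)) (norm_nonneg _) (by linarith))

/-- If the joint spectral radius of a bounded family is less than `1`, its products decay
exponentially. -/
theorem exists_norm_list_prod_le_geometric {𝓜 : Set (V →L[ℝ] V)} {B : ℝ}
    (hB : ∀ L ∈ 𝓜, ‖L‖ ≤ B) (h : jointSpectralRadius 𝓜 < 1) :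
    ∃ q C : ℝ, 0 < q ∧ q < 1 ∧ ∀ l : List (V →L[ℝ] V), (∀ L ∈ l, L ∈ 𝓜) →
      ‖l.prod‖ ≤ C * q ^ l.length := by
  obtain ⟨q, hq1, hq2⟩ := ENNReal.lt_iff_exists_nnreal_btwn.1 h
  have hq2' : q < 1 := by exact_mod_cast hq2
  have hq0 : 0 < q := by
    have := (zero_le (a := jointSpectralRadius 𝓜)).trans_lt hq1
    exact_mod_cast this
  obtain ⟨n₀, hn₀⟩ := eventually_atTop.1 (eventually_lt_of_limsup_lt hq1)
  have hq0' : (0 : ℝ) < q := hq0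
  have hB1 : (1 : ℝ) ≤ max 1 B := le_max_left _ _
  -- The constant only serves the products of length at most `n₀`; longer ones satisfy the bound
  -- with constant `1`.
  refine ⟨q, max 1 B ^ (n₀ + 1) / q ^ (n₀ + 1), hq0', hq2', fun l hl => ?_⟩
  by_cases hlen : n₀ + 1 ≤ l.length
  · have h1 := hn₀ l.length (by omega)
    have hn : (0 : ℝ) < l.length := by
      have : 0 < l.length := by omega
      exact_mod_cast this
    have h2 := ENNReal.rpow_le_rpow h1.le hn.le
    rw [← ENNReal.rpow_mul, one_div, inv_mul_cancel₀ hn.ne', ENNReal.rpow_one,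
      ENNReal.rpow_natCast] at h2
    have h3 := (le_iSup (fun w : Fin l.length → 𝓜 =>
      ‖(List.ofFn fun i => (w i : V →L[ℝ] V)).prod‖ₑ)
      (fun i => ⟨l.get i, hl _ (l.get_mem i)⟩)).trans h2
    simp only [List.ofFn_get] at h3
    have h4 : ‖l.prod‖ ≤ (q : ℝ) ^ l.length := by
      rw [enorm_eq_nnnorm] at h3
      exact_mod_cast h3
    refine h4.trans (le_mul_of_one_le_left (by positivity) ?_)
    rw [one_le_div (by positivity)]
    exact pow_le_pow_left₀ hq0'.le (le_trans (NNReal.coe_le_one.2 hq2'.le) hB1) _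
  · refine (norm_list_prod_le_pow hB1 (fun L hL => (hB L hL).trans (le_max_right _ _)) l hl).trans
      ?_
    rw [div_mul_eq_mul_div, le_div_iff₀ (by positivity)]
    exact mul_le_mul (pow_le_pow_right₀ hB1 (by omega))
      (pow_le_pow_of_le_one hq0'.le hq2'.le (by omega)) (by positivity) (by positivity)

/-- An equivalent norm for which all members of the family are contractions with a common
factor. -/
theorem exists_adapted_norm {𝓜 : Set (V →L[ℝ] V)} {B : ℝ}
    (hB : ∀ L ∈ 𝓜, ‖L‖ ≤ B) (h : jointSpectralRadius 𝓜 < 1) :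
    ∃ (ν : V → ℝ) (q C : ℝ), 0 < q ∧ q < 1 ∧ 0 ≤ C ∧ (∀ v, ‖v‖ ≤ ν v) ∧ (∀ v, ν v ≤ C * ‖v‖) ∧
      (∀ v w, ν (v + w) ≤ ν v + ν w) ∧ ∀ L ∈ 𝓜, ∀ v, ν (L v) ≤ q * ν v := by
  obtain ⟨q, C, hq0, hq1, hC⟩ := exists_norm_list_prod_le_geometric hB h
  let ι := {l : List (V →L[ℝ] V) // ∀ L ∈ l, L ∈ 𝓜}
  let e : ι := ⟨[], by simp⟩
  have : Nonempty ι := ⟨e⟩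
  -- The new norm is the supremum of `q^{-n} ‖P v‖` over all products `P` of length `n`. The empty
  -- product gives `‖v‖ ≤ ν v`; appending `L` to a product lengthens it by one, which produces the
  -- factor `q`.
  let φ : V → ι → ℝ := fun v l => (q ^ l.1.length)⁻¹ * ‖l.1.prod v‖
  have hφ : ∀ v l, φ v l ≤ C * ‖v‖ := fun v l => by
    rw [inv_mul_le_iff₀ (by positivity)]
    calc _ ≤ ‖l.1.prod‖ * ‖v‖ := ContinuousLinearMap.le_opNorm _ _
      _ ≤ (C * q ^ l.1.length) * ‖v‖ := by gcongr; exact hC l.1 l.2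
      _ = _ := by ring
  have hbdd : ∀ v, BddAbove (Set.range (φ v)) := fun v => ⟨C * ‖v‖, by
    rintro _ ⟨l, rfl⟩
    exact hφ v l⟩
  have hCn : 0 ≤ C := by
    have := (norm_nonneg _).trans (hC [] (by simp))
    simpa using this
  refine ⟨fun v => ⨆ l, φ v l, q, C, hq0, hq1, hCn, fun v => ?_, fun v => ciSup_le (hφ v),
    fun v w => ciSup_le fun l => ?_, fun L hL v => ciSup_le fun l => ?_⟩
  · have := le_ciSup (hbdd v) e
    simpa [φ, e] using this
  · refine le_trans ?_ (add_le_add (le_ciSup (hbdd v) l) (le_ciSup (hbdd w) l))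
    simp only [φ, map_add, ← mul_add]
    gcongr
    exact norm_add_le _ _
  · have h1 := le_ciSup (hbdd v) ⟨l.1 ++ [L], fun L' hL' => by
      rcases List.mem_append.1 hL' with h | h
      · exact l.2 _ h
      · rw [List.mem_singleton.1 h]
        exact hL⟩
    refine le_trans (le_of_eq ?_) (mul_le_mul_of_nonneg_left h1 hq0.le)
    simp only [φ, List.length_append, List.length_singleton, List.prod_append, List.prod_singleton,
      mul_apply_eq_comp]
    field_simp
    ring

end AdaptedNorm

/-! ### Local estimates for the subdivision operator -/

section Subdivision

variable {s N : ℕ} {M : Matrix (Fin s) (Fin s) ℤ} {b : Mask s} {B : ℝ}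

theorem exists_finset_subdivision_eq_sum (hM : M.det ≠ 0) (hb : b.SupportedIn N)
    (y : Fin s → ℤ) : ∃ T : Finset (Fin s → ℤ), T.card ≤ (cubeFinset s N).card ∧
      (∀ β ∈ T, y - M *ᵥ β ∈ cube s N) ∧ (∀ β ∉ T, b (y - M *ᵥ β) = 0) ∧
      ∀ c : (Fin s → ℤ) → ℝ, subdivision M b c y = ∑ β ∈ T, b (y - M *ᵥ β) * c β := by
  have hinj : Function.Injective fun β : Fin s → ℤ => y - M *ᵥ β :=
    sub_right_injective.comp (mulVec_intMat_injective hM)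
  obtain ⟨T, hT⟩ : ∃ T : Finset (Fin s → ℤ), ∀ β, β ∈ T ↔ y - M *ᵥ β ∈ cubeFinset s N :=
    ⟨(cubeFinset s N).preimage (fun β => y - M *ᵥ β) hinj.injOn, fun _ => Finset.mem_preimage⟩
  have h0 : ∀ β ∉ T, b (y - M *ᵥ β) = 0 := fun β hβ => hb.eq_zero (mt (hT β).2 hβ)
  refine ⟨T, Finset.card_le_card_of_injOn (fun β => y - M *ᵥ β) (fun β hβ => (hT β).1 hβ)
    hinj.injOn, fun β hβ => mem_cubeFinset.1 ((hT β).1 hβ), h0, fun c => ?_⟩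
  exact tsum_eq_sum fun β hβ => by rw [h0 β hβ, zero_mul]

theorem abs_subdivision_le (hM : M.det ≠ 0) (hb : b.SupportedIn N) (hB : ∀ α, |b α| ≤ B)
    {c : (Fin s → ℤ) → ℝ} {y : Fin s → ℤ} {H : ℝ} (hH0 : 0 ≤ H)
    (hH : ∀ β, y - M *ᵥ β ∈ cube s N → |c β| ≤ H) :
    |subdivision M b c y| ≤ (cubeFinset s N).card * B * H := by
  obtain ⟨T, hT, hTc, -, hsum⟩ := exists_finset_subdivision_eq_sum hM hb y
  have hB0 : 0 ≤ B := (abs_nonneg _).trans (hB 0)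
  rw [hsum]
  calc _ ≤ ∑ β ∈ T, |b (y - M *ᵥ β) * c β| := Finset.abs_sum_le_sum_abs _ _
    _ ≤ ∑ β ∈ T, B * H := Finset.sum_le_sum fun β hβ => by
        rw [abs_mul]
        exact mul_le_mul (hB _) (hH β (hTc β hβ)) (abs_nonneg _) hB0
    _ = T.card * (B * H) := by rw [Finset.sum_const, nsmul_eq_mul]
    _ ≤ (cubeFinset s N).card * (B * H) := by gcongr
    _ = _ := by ring

theorem subdivision_sub_const (hM : M.det ≠ 0) (hb : b.SupportedIn N)
    (c : (Fin s → ℤ) → ℝ) (y : Fin s → ℤ) (r : ℝ) :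
    subdivision M b (fun β => c β - r) y
      = subdivision M b c y - r * subdivision M b (fun _ => 1) y := by
  obtain ⟨T, -, -, -, hsum⟩ := exists_finset_subdivision_eq_sum hM hb y
  rw [hsum, hsum, hsum, Finset.mul_sum, ← Finset.sum_sub_distrib]
  exact Finset.sum_congr rfl fun β _ => by ring

/-- Write `S c - r = S(c - r) + r (S 1 - 1)`: a nearly constant patch stays near the same constant.
-/
theorem abs_subdivision_sub_le (hM : M.det ≠ 0) (hb : b.SupportedIn N) (hB : ∀ α, |b α| ≤ B)
    {τ : ℝ} {c : (Fin s → ℤ) → ℝ} {y : Fin s → ℤ}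
    (hτ : |subdivision M b (fun _ => 1) y - 1| ≤ τ) {H r : ℝ} (hH0 : 0 ≤ H)
    (hH : ∀ β, y - M *ᵥ β ∈ cube s N → |c β - r| ≤ H) :
    |subdivision M b c y - r| ≤ (cubeFinset s N).card * B * H + τ * |r| := by
  have h1 := abs_subdivision_le hM hb hB hH0 hH
  rw [subdivision_sub_const hM hb] at h1
  have h2 : subdivision M b c y - r
      = (subdivision M b c y - r * subdivision M b (fun _ => 1) y)
        + (subdivision M b (fun _ => 1) y - 1) * r := by ring
  rw [h2]
  refine (abs_add_le _ _).trans (add_le_add h1 ?_)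
  rw [abs_mul]
  exact mul_le_mul_of_nonneg_right hτ (abs_nonneg _)

theorem subdivision_shift (c : (Fin s → ℤ) → ℝ) (ε x u : Fin s → ℤ) :
    subdivision M b c (ε + M *ᵥ x - u)
      = ∑' α : Fin s → ℤ, b (ε + M *ᵥ α - u) * c (x - α) := by
  rw [subdivision, ← (Equiv.subLeft x).tsum_eq]
  refine tsum_congr fun α => ?_
  simp only [Equiv.subLeft_apply, Matrix.mulVec_sub]
  congr 2
  abel

end Subdivision

/-! ### Limit points -/

section LimitPoints

variable {s N : ℕ} {M : Matrix (Fin s) (Fin s) ℤ} {b : ℕ → Mask s} {B : ℝ} {a : Mask s}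

theorem supportedIn_of_mem_limitPoints (hb : ∀ k, (b k).SupportedIn N)
    (ha : a ∈ limitPoints b) : a.SupportedIn N := by
  obtain ⟨φ, _, hlim⟩ := ha
  intro α hα
  refine tendsto_nhds_unique (tendsto_pi_nhds.1 hlim α) ?_
  simp only [hb _ α hα, tendsto_const_nhds]

theorem abs_le_of_mem_limitPoints (hB : ∀ k α, |b k α| ≤ B) (ha : a ∈ limitPoints b)
    (α : Fin s → ℤ) : |a α| ≤ B := by
  obtain ⟨φ, _, hlim⟩ := ha
  exact le_of_tendsto (tendsto_pi_nhds.1 hlim α).abs (Eventually.of_forall fun n => hB _ α)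

/-- Coset sums are finite sums of mask entries, hence continuous under pointwise limits. -/
theorem subdivision_one_of_mem_limitPoints (hM : M.det ≠ 0) (hb : ∀ k, (b k).SupportedIn N)
    {τ : ℕ → ℝ} (hτ : Tendsto τ atTop (𝓝 0))
    (hbτ : ∀ k y, |subdivision M (b k) (fun _ => 1) y - 1| ≤ τ k)
    (ha : a ∈ limitPoints b) (y : Fin s → ℤ) : subdivision M a (fun _ => 1) y = 1 := by
  have hasupp := supportedIn_of_mem_limitPoints hb ha
  obtain ⟨φ, hφ, hlim⟩ := ha
  have h1 : Tendsto (fun n => subdivision M (b (φ n)) (fun _ => 1) y) atTop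
      (𝓝 (subdivision M a (fun _ => 1) y)) := by
    simp only [subdivision_one_eq_sum hM (hb _), subdivision_one_eq_sum hM hasupp]
    refine tendsto_finsetSum _ fun α _ => ?_
    split_ifs
    · exact tendsto_pi_nhds.1 hlim α
    · exact tendsto_const_nhds
  refine tendsto_nhds_unique h1 ?_
  rw [tendsto_iff_norm_sub_tendsto_zero]
  exact squeeze_zero (fun _ => norm_nonneg _) (fun n => hbτ (φ n) y)
    (hτ.comp hφ.tendsto_atTop)

/-- Otherwise a subsequence stays away from all limit points, yet compactness of a product of
intervals gives it a convergent subsequence. The common finite support upgrades pointwise to uniform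
closeness. -/
theorem eventually_near_limitPoints (hb : ∀ k, (b k).SupportedIn N)
    (hB : ∀ k α, |b k α| ≤ B) {η : ℝ} (hη : 0 < η) :
    ∀ᶠ k in atTop, ∃ a ∈ limitPoints b, ∀ α, |b k α - a α| ≤ η := by
  by_contra hcon
  obtain ⟨φ, hφ, hbad⟩ := extraction_of_frequently_atTop (not_eventually.1 hcon)
  have hcomp : IsCompact (Set.univ.pi fun _ : Fin s → ℤ => Set.Icc (-B) B) :=
    isCompact_univ_pi fun _ => isCompact_Icc
  obtain ⟨a, -, ψ, hψ, hlim⟩ := hcomp.tendsto_subseq (x := fun n => b (φ n))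
    (fun n α _ => abs_le.1 (hB _ α))
  have ha : a ∈ limitPoints b := ⟨φ ∘ ψ, hφ.comp hψ, hlim⟩
  have hev : ∀ᶠ n in atTop, ∀ α ∈ cubeFinset s N, |b (φ (ψ n)) α - a α| ≤ η := by
    rw [Filter.eventually_all_finset]
    intro α _
    have h1 := tendsto_pi_nhds.1 hlim α
    rw [tendsto_iff_norm_sub_tendsto_zero] at h1
    exact (h1.eventually (gt_mem_nhds hη)).mono fun n hn => hn.le
  obtain ⟨n, hn⟩ := hev.exists
  refine hbad (ψ n) ⟨a, ha, fun α => ?_⟩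
  by_cases hα : α ∈ cubeFinset s N
  · exact hn α hα
  · rw [(hb _).eq_zero hα, (supportedIn_of_mem_limitPoints hb ha).eq_zero hα]
    simpa using hη.le

end LimitPoints

/-! ### Differences of the subdivision data on the index set -/

/-- The pairing `∑_{β ∈ K} v(β) c(x - β)`. -/
def windowPairing {s : ℕ} (K : Finset (Fin s → ℤ)) (c : (Fin s → ℤ) → ℝ) (x : Fin s → ℤ)
    (v : K → ℝ) : ℝ := ∑ β : K, v β * c (x - β.1)

section Window

variable {s N : ℕ} {M : Matrix (Fin s) (Fin s) ℤ} {K E : Finset (Fin s → ℤ)} {b : Mask s}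
  {B : ℝ}

theorem windowPairing_add (c : (Fin s → ℤ) → ℝ) (x : Fin s → ℤ) (v w : K → ℝ) :
    windowPairing K c x (v + w) = windowPairing K c x v + windowPairing K c x w := by
  simp [windowPairing, add_mul, Finset.sum_add_distrib]

theorem windowPairing_smul (c : (Fin s → ℤ) → ℝ) (x : Fin s → ℤ) (t : ℝ) (v : K → ℝ) :
    windowPairing K c x (t • v) = t * windowPairing K c x v := by
  simp [windowPairing, mul_assoc, Finset.mul_sum]

theorem windowPairing_single (c : (Fin s → ℤ) → ℝ) (x : Fin s → ℤ) (κ : K) :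
    windowPairing K c x (Pi.single κ 1) = c (x - κ.1) := by
  simp [windowPairing, Pi.single_apply]

theorem windowPairing_one (x : Fin s → ℤ) (v : K → ℝ) :
    windowPairing K (fun _ => 1) x v = ∑ α, v α := by
  simp [windowPairing]

theorem sum_abs_le (v : K → ℝ) : ∑ β, |v β| ≤ K.card * ‖v‖ := by
  calc ∑ β, |v β| ≤ ∑ _β : K, ‖v‖ := Finset.sum_le_sum fun β _ => norm_le_pi_norm v β
    _ = _ := by simp

theorem abs_windowPairing_le {c : (Fin s → ℤ) → ℝ} {C : ℝ} (hc : ∀ x, |c x| ≤ C)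
    (x : Fin s → ℤ) (v : K → ℝ) : |windowPairing K c x v| ≤ C * (K.card * ‖v‖) := by
  have hC : 0 ≤ C := (abs_nonneg _).trans (hc 0)
  refine (Finset.abs_sum_le_sum_abs _ _).trans (le_trans ?_
    (mul_le_mul_of_nonneg_left (sum_abs_le v) hC))
  rw [Finset.mul_sum]
  refine Finset.sum_le_sum fun β _ => ?_
  rw [abs_mul, mul_comm]
  exact mul_le_mul_of_nonneg_right (hc _) (abs_nonneg _)

theorem abs_sum_le_card_mul_norm (v : K → ℝ) : |∑ α, v α| ≤ K.card * ‖v‖ :=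
  (Finset.abs_sum_le_sum_abs _ _).trans (sum_abs_le v)

theorem norm_transitionMatrix_mulVec_le {ε : Fin s → ℤ} (hB : ∀ α, |b α| ≤ B) (v : K → ℝ) :
    ‖transitionMatrix M K ε b *ᵥ v‖ ≤ B * (K.card * ‖v‖) := by
  have hB0 : 0 ≤ B := (abs_nonneg _).trans (hB 0)
  rw [pi_norm_le_iff_of_nonneg (by positivity)]
  intro α
  refine (Finset.abs_sum_le_sum_abs _ _).trans (le_trans ?_
    (mul_le_mul_of_nonneg_left (sum_abs_le v) hB0))
  rw [Finset.mul_sum]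
  refine Finset.sum_le_sum fun β _ => ?_
  rw [abs_mul]
  exact mul_le_mul_of_nonneg_right (hB _) (abs_nonneg _)

/-- The transition matrices describe the action of the subdivision operator on windows. -/
theorem windowPairing_subdivision (hK : reach M N E K ⊆ K) (hb : b.SupportedIn N)
    {ε : Fin s → ℤ} (hε : ε ∈ E) (c : (Fin s → ℤ) → ℝ) (x : Fin s → ℤ) (v : K → ℝ) :
    windowPairing K (subdivision M b c) (ε + M *ᵥ x) v
      = windowPairing K c x (transitionMatrix M K ε b *ᵥ v) := by
  have h1 : ∀ β : K, subdivision M b c (ε + M *ᵥ x - β.1)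
      = ∑ α : K, b (ε + M *ᵥ α.1 - β.1) * c (x - α.1) := fun β => by
    rw [subdivision_shift, Finset.sum_coe_sort K fun α => b (ε + M *ᵥ α - β.1) * c (x - α)]
    -- A nonzero coefficient with `β ∈ K` would put `α` into `reach M N E K ⊆ K`, so truncation to
    -- `K` loses nothing.
    refine tsum_eq_sum fun α hα => ?_
    rw [hb, zero_mul]
    intro hmem
    exact hα (hK ⟨β.1, β.2, _, hmem, ε, hε, by abel⟩)
  simp only [windowPairing, h1, Finset.mul_sum, Matrix.mulVec, dotProduct, Finset.sum_mul,
    transitionMatrix, Matrix.of_apply]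
  rw [Finset.sum_comm]
  exact Finset.sum_congr rfl fun α _ => Finset.sum_congr rfl fun β _ => by ring

/-- Pair with the constant sequence: the total mass of `T v` is the pairing of `S_b 1` with `v`. -/
theorem abs_sum_transitionMatrix_sub_le (hK : reach M N E K ⊆ K) (hb : b.SupportedIn N)
    {τ : ℝ} (hτ : ∀ y, |subdivision M b (fun _ => 1) y - 1| ≤ τ)
    {ε : Fin s → ℤ} (hε : ε ∈ E) (v : K → ℝ) :
    |∑ α, (transitionMatrix M K ε b *ᵥ v) α - ∑ α, v α| ≤ τ * (K.card * ‖v‖) := by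
  have h1 := abs_windowPairing_le (c := fun y => subdivision M b (fun _ => 1) y - 1) hτ
    (ε + M *ᵥ (0 : Fin s → ℤ)) v
  rw [← windowPairing_one 0 (transitionMatrix M K ε b *ᵥ v), ← windowPairing_subdivision hK hb hε]
  convert h1 using 2
  simp [windowPairing, mul_sub]

theorem transitionMatrix_sub_mulVec (ε : Fin s → ℤ) (a b : Mask s) (v : K → ℝ) :
    transitionMatrix M K ε b *ᵥ v
      = transitionMatrix M K ε a *ᵥ v + transitionMatrix M K ε (b - a) *ᵥ v := by
  rw [← Matrix.add_mulVec]
  congr 1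
  ext α β
  simp [transitionMatrix]

/-- If a mask satisfies the sum rules, its transition matrices restrict to the difference
space. -/
theorem exists_mem_restrictedFamily (hK : reach M N E K ⊆ K) {a : Mask s} (ha : a.SupportedIn N)
    (h1 : ∀ y, subdivision M a (fun _ => 1) y = 1) {ε : Fin s → ℤ} (hε : ε ∈ E)
    {A : Set (Mask s)} (haA : a ∈ A) :
    ∃ L ∈ restrictedFamily M K E A, ∀ v : diffSpace K,
      (L v : K → ℝ) = transitionMatrix M K ε a *ᵥ (v : K → ℝ) := by
  have hinv : ∀ v ∈ diffSpace K, (transitionMatrix M K ε a).mulVecLin v ∈ diffSpace K := by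
    intro v hv
    have hv' : ∑ α, v α = 0 := hv
    have h2 := abs_sum_transitionMatrix_sub_le hK ha (τ := 0) (fun y => by rw [h1]; simp) hε v
    rw [hv', zero_mul, sub_zero] at h2
    exact abs_nonpos_iff.1 h2
  let L := LinearMap.toContinuousLinearMap ((transitionMatrix M K ε a).mulVecLin.restrict hinv)
  exact ⟨L, ⟨ε, hε, a, haA, fun _ => rfl⟩, fun _ => rfl⟩

theorem norm_le_of_mem_restrictedFamily {A : Set (Mask s)} (hB : ∀ a ∈ A, ∀ α, |a α| ≤ B)
    {L : diffSpace K →L[ℝ] diffSpace K} (hL : L ∈ restrictedFamily M K E A) :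
    ‖L‖ ≤ |B| * K.card := by
  obtain ⟨ε, _, a, ha, h⟩ := hL
  refine ContinuousLinearMap.opNorm_le_bound _ (by positivity) fun v => ?_
  change ‖(L v : K → ℝ)‖ ≤ |B| * K.card * ‖(v : K → ℝ)‖
  rw [h, mul_assoc]
  exact norm_transitionMatrix_mulVec_le (fun α => (hB a ha α).trans (le_abs_self B)) _

end Window

/-! ### One subdivision step -/

section Step

variable {s N : ℕ} {M : Matrix (Fin s) (Fin s) ℤ} {K E : Finset (Fin s → ℤ)} {b : Mask s}
  {B : ℝ} {ν : diffSpace K → ℝ} {q Cν : ℝ} {c : (Fin s → ℤ) → ℝ} {C D : ℝ}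

theorem norm_single_one_le (κ : K) : ‖(Pi.single κ 1 : K → ℝ)‖ ≤ 1 := by
  rw [pi_norm_le_iff_of_nonneg zero_le_one]
  intro β
  rw [Pi.single_apply]
  split_ifs <;> simp

/-- The perturbation `w` need not lie in `V_0`. Its mass `m` is moved to a point mass at `κ`: the
remainder is in `V_0` and is controlled by `D`, while the point mass only costs `|m| C`. -/
theorem abs_windowPairing_add_le (κ : K) (hCν : 0 ≤ Cν) (hν : ∀ v, ν v ≤ Cν * ‖v‖)
    (hν_add : ∀ v w, ν (v + w) ≤ ν v + ν w) (hc : ∀ x, |c x| ≤ C) (hD0 : 0 ≤ D)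
    (hD : ∀ x (v : diffSpace K), |windowPairing K c x v| ≤ D * ν v)
    (x : Fin s → ℤ) (u : diffSpace K) (w : K → ℝ) :
    |windowPairing K c x (u + w)|
      ≤ D * (ν u + Cν * ((1 + K.card) * ‖w‖)) + |∑ α, w α| * C := by
  set m := ∑ α, w α with hm
  have hw : w - m • (Pi.single κ 1 : K → ℝ) ∈ diffSpace K := by
    change ∑ α, (w - m • (Pi.single κ 1 : K → ℝ)) α = 0
    simp [Finset.sum_sub_distrib, Pi.single_apply, hm]
  set w₀ : diffSpace K := ⟨_, hw⟩
  have hdec : (u : K → ℝ) + w = ((u + w₀ : diffSpace K) : K → ℝ) + m • Pi.single κ 1 := by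
    simp only [w₀, Submodule.coe_add]
    abel
  have hw₀ : ‖w₀‖ ≤ (1 + K.card) * ‖w‖ := by
    change ‖w - m • (Pi.single κ 1 : K → ℝ)‖ ≤ _
    refine (norm_sub_le _ _).trans ?_
    rw [norm_smul, add_mul, one_mul]
    refine add_le_add_right ?_ _
    calc ‖m‖ * ‖(Pi.single κ 1 : K → ℝ)‖ ≤ ‖m‖ * 1 := by
          gcongr
          exact norm_single_one_le κ
      _ = |m| := by rw [mul_one, Real.norm_eq_abs]
      _ ≤ _ := abs_sum_le_card_mul_norm w
  rw [hdec, windowPairing_add, windowPairing_smul, windowPairing_single]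
  refine (abs_add_le _ _).trans (add_le_add ((hD x _).trans ?_) ?_)
  · refine mul_le_mul_of_nonneg_left ((hν_add _ _).trans ?_) hD0
    refine add_le_add_right ((hν _).trans ?_) _
    exact mul_le_mul_of_nonneg_left hw₀ hCν
  · rw [abs_mul]
    exact mul_le_mul_of_nonneg_left (hc _) (abs_nonneg _)

/-- A single value is a pairing with a point mass, and the image of that point mass under `T` has
mass at most `1 + τ`. This yields the growth factor `1 + τ` in place of the crude constant of
`abs_subdivision_le`, as boundedness over infinitely many levels requires. -/
theorem abs_subdivision_le_of_windows (hE : IsCosetReps M E) (hK : reach M N E K ⊆ K)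
    (hb : b.SupportedIn N) (hB : ∀ α, |b α| ≤ B)
    {τ : ℝ} (hτ : ∀ y, |subdivision M b (fun _ => 1) y - 1| ≤ τ)
    (κ : K) (hCν : 0 ≤ Cν) (hν : ∀ v, ν v ≤ Cν * ‖v‖)
    (hν_add : ∀ v w, ν (v + w) ≤ ν v + ν w) (hc : ∀ x, |c x| ≤ C) (hD0 : 0 ≤ D)
    (hD : ∀ x (v : diffSpace K), |windowPairing K c x v| ≤ D * ν v) (y : Fin s → ℤ) :
    |subdivision M b c y| ≤ (1 + τ) * C + Cν * ((1 + K.card) * B) * D := by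
  obtain ⟨ε, ⟨hε, x, hx⟩, -⟩ := hE (y + κ.1)
  have hy : subdivision M b c y
      = windowPairing K (subdivision M b c) (ε + M *ᵥ x) (Pi.single κ 1) := by
    rw [windowPairing_single, ← hx, add_sub_cancel_right]
  have hC : 0 ≤ C := (abs_nonneg _).trans (hc 0)
  rw [hy, windowPairing_subdivision hK hb hε]
  have h1 := abs_windowPairing_add_le κ hCν hν hν_add hc hD0 hD x 0
    (transitionMatrix M K ε b *ᵥ Pi.single κ 1)
  rw [Submodule.coe_zero, zero_add] at h1
  refine h1.trans ?_
  have h2 : |∑ α, (transitionMatrix M K ε b *ᵥ Pi.single κ 1) α| ≤ 1 + τ := by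
    rw [← windowPairing_one x, ← windowPairing_subdivision hK hb hε, windowPairing_single]
    have := abs_le.1 (hτ (ε + M *ᵥ x - κ.1))
    rw [abs_le]
    constructor <;> linarith [(abs_nonneg _).trans (hτ 0)]
  have h3 : ‖transitionMatrix M K ε b *ᵥ Pi.single κ 1‖ ≤ B := by
    rw [pi_norm_le_iff_of_nonneg ((abs_nonneg _).trans (hB 0))]
    intro α
    rw [Matrix.mulVec_single_one]
    exact hB _
  have h4 : ν 0 ≤ 0 := by simpa using hν 0
  have h5 : D * (ν 0 + Cν * ((1 + K.card) * ‖transitionMatrix M K ε b *ᵥ Pi.single κ 1‖))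
      ≤ Cν * ((1 + K.card) * B) * D := by
    rw [mul_comm _ D]
    refine mul_le_mul_of_nonneg_left ?_ hD0
    have : Cν * ((1 + K.card) * ‖transitionMatrix M K ε b *ᵥ Pi.single κ 1‖)
        ≤ Cν * ((1 + K.card) * B) := by gcongr
    linarith
  have h6 := mul_le_mul_of_nonneg_right h2 hC
  linarith

/-- Split `T_b v = T_a v + T_{b-a} v`. The first term stays in `V_0` and is contracted by `q`; the
second has norm of order `η` and, since `T_a v` has mass zero, mass of order `τ` only. -/
theorem abs_windowPairing_subdivision_le (hE : IsCosetReps M E) (hK : reach M N E K ⊆ K)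
    (hb : b.SupportedIn N)
    {τ : ℝ} (hτ : ∀ y, |subdivision M b (fun _ => 1) y - 1| ≤ τ)
    {a : Mask s} (ha : a.SupportedIn N) (ha1 : ∀ y, subdivision M a (fun _ => 1) y = 1)
    {η : ℝ} (hη : ∀ α, |b α - a α| ≤ η) {A : Set (Mask s)} (haA : a ∈ A)
    (κ : K) (hCν : 0 ≤ Cν) (hν_ge : ∀ v, ‖v‖ ≤ ν v) (hν : ∀ v, ν v ≤ Cν * ‖v‖)
    (hν_add : ∀ v w, ν (v + w) ≤ ν v + ν w)
    (hν_contr : ∀ L ∈ restrictedFamily M K E A, ∀ v, ν (L v) ≤ q * ν v)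
    (hc : ∀ x, |c x| ≤ C) (hD0 : 0 ≤ D)
    (hD : ∀ x (v : diffSpace K), |windowPairing K c x v| ≤ D * ν v)
    (y : Fin s → ℤ) (v : diffSpace K) :
    |windowPairing K (subdivision M b c) y v|
      ≤ ((q + Cν * ((1 + K.card) * (η * K.card))) * D + K.card * τ * C) * ν v := by
  obtain ⟨ε, ⟨hε, x, rfl⟩, -⟩ := hE y
  have hC : 0 ≤ C := (abs_nonneg _).trans (hc 0)
  have hη0 : 0 ≤ η := (abs_nonneg _).trans (hη 0)
  have hτ0 : 0 ≤ τ := (abs_nonneg _).trans (hτ 0)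
  obtain ⟨L, hL, hLv⟩ := exists_mem_restrictedFamily hK ha ha1 hε haA
  rw [windowPairing_subdivision hK hb hε, transitionMatrix_sub_mulVec ε a b, ← hLv]
  refine (abs_windowPairing_add_le κ hCν hν hν_add hc hD0 hD x _ _).trans ?_
  have hv : ‖(v : K → ℝ)‖ ≤ ν v := hν_ge v
  have h1 : |∑ α, (transitionMatrix M K ε (b - a) *ᵥ (v : K → ℝ)) α| ≤ K.card * τ * ν v := by
    have h2 := abs_sum_transitionMatrix_sub_le hK hb hτ hε (v : K → ℝ)
    have h3 : ∑ α, (v : K → ℝ) α = 0 := v.2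
    have h4 : ∑ α, (L v : K → ℝ) α = 0 := (L v).2
    rw [h3, sub_zero, transitionMatrix_sub_mulVec ε a b, ← hLv] at h2
    simp only [Pi.add_apply, Finset.sum_add_distrib, h4, zero_add] at h2
    refine h2.trans ?_
    rw [← mul_assoc, mul_comm τ]
    gcongr
  have h5 : ‖transitionMatrix M K ε (b - a) *ᵥ (v : K → ℝ)‖ ≤ η * K.card * ν v := by
    refine (norm_transitionMatrix_mulVec_le (b := b - a) hη (v : K → ℝ)).trans ?_
    rw [← mul_assoc]
    gcongr
  have h6 : ν (L v) + Cν * ((1 + K.card) * ‖transitionMatrix M K ε (b - a) *ᵥ (v : K → ℝ)‖)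
      ≤ q * ν v + Cν * ((1 + K.card) * (η * K.card * ν v)) :=
    add_le_add (hν_contr L hL v) (by gcongr)
  calc _ ≤ D * (q * ν v + Cν * ((1 + K.card) * (η * K.card * ν v))) + K.card * τ * ν v * C :=
        add_le_add (mul_le_mul_of_nonneg_left h6 hD0) (mul_le_mul_of_nonneg_right h1 hC)
    _ = _ := by ring

end Step

/-! ### Coupled recursions -/

/-- A bounded sequence driving a perturbed contraction. -/
theorem exists_bound_and_summable_of_coupled {C D τ : ℕ → ℝ} {q Λ Λ' : ℝ} (hq0 : 0 ≤ q)
    (hq1 : q < 1) (hΛ : 0 ≤ Λ) (hΛ' : 0 ≤ Λ') (hτ0 : ∀ k, 0 ≤ τ k) (hτ : Summable τ)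
    (hC0 : 0 ≤ C 0) (hD0 : 0 ≤ D 0) (hC : ∀ k, C (k + 1) = (1 + τ k) * C k + Λ * D k)
    (hD : ∀ k, D (k + 1) = q * D k + Λ' * τ k * C k) :
    (∃ R, ∀ k, C k ≤ R) ∧ (∀ k, 0 ≤ C k) ∧ (∀ k, 0 ≤ D k) ∧ Summable D := by
  have hnn : ∀ k, 0 ≤ C k ∧ 0 ≤ D k := fun k => by
    induction k with
    | zero => exact ⟨hC0, hD0⟩
    | succ k ih =>
      rw [hC, hD]
      have := hτ0 k
      obtain ⟨h1, h2⟩ := ih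
      constructor <;> positivity
  have h1q : 0 < 1 - q := by linarith
  -- This weight solves `Λ + b q = b`, so `C + b D` grows by at most a factor `1 + (1 + b Λ') τ` per
  -- step.
  set b := Λ / (1 - q) with hb
  have hb0 : 0 ≤ b := by positivity
  have hbq : Λ + b * q = b := by
    rw [hb]
    field_simp
    ring
  have hF : ∀ k, C k + b * D k
      ≤ (C 0 + b * D 0) * Real.exp ((1 + b * Λ') * ∑ j ∈ Finset.range k, τ j) := fun k => by
    induction k with
    | zero => simp
    | succ k ih =>
      have h2 : C (k + 1) + b * D (k + 1)
          ≤ (C k + b * D k) * (1 + (1 + b * Λ') * τ k) := by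
        rw [hC, hD]
        have h3 : (1 + τ k) * C k + Λ * D k + b * (q * D k + Λ' * τ k * C k)
            = C k * (1 + (1 + b * Λ') * τ k) + (Λ + b * q) * D k := by ring
        rw [h3, hbq]
        have h4 : 0 ≤ b * D k * ((1 + b * Λ') * τ k) := by
          have := hτ0 k
          have := (hnn k).2
          positivity
        linarith
      have h5 : 1 + (1 + b * Λ') * τ k ≤ Real.exp ((1 + b * Λ') * τ k) := by
        rw [add_comm]
        exact Real.add_one_le_exp _
      have hFk : 0 ≤ C k + b * D k := add_nonneg (hnn k).1 (mul_nonneg hb0 (hnn k).2)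
      calc _ ≤ _ := h2
        _ ≤ (C k + b * D k) * Real.exp ((1 + b * Λ') * τ k) := by gcongr
        _ ≤ (C 0 + b * D 0) * Real.exp ((1 + b * Λ') * ∑ j ∈ Finset.range k, τ j)
              * Real.exp ((1 + b * Λ') * τ k) := by gcongr
        _ = _ := by rw [mul_assoc, ← Real.exp_add, Finset.sum_range_succ, mul_add]
  obtain ⟨R, hR⟩ : ∃ R, ∀ k, C k ≤ R := by
    refine ⟨(C 0 + b * D 0) * Real.exp ((1 + b * Λ') * ∑' j, τ j), fun k => ?_⟩
    have h1 := hF k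
    have h2 : ∑ j ∈ Finset.range k, τ j ≤ ∑' j, τ j := hτ.sum_le_tsum _ fun j _ => hτ0 j
    have h3 : (C 0 + b * D 0) * Real.exp ((1 + b * Λ') * ∑ j ∈ Finset.range k, τ j)
        ≤ (C 0 + b * D 0) * Real.exp ((1 + b * Λ') * ∑' j, τ j) := by gcongr
    have h4 := mul_nonneg hb0 (hnn k).2
    linarith
  refine ⟨⟨R, hR⟩, fun k => (hnn k).1, fun k => (hnn k).2, ?_⟩
  have hR0 : 0 ≤ R := hC0.trans (hR 0)
  -- Sum the recursion for `D` with `C ≤ R` and absorb the term `q ∑ D` on the left.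
  refine summable_of_sum_range_le (c := (D 0 + Λ' * R * ∑' j, τ j) / (1 - q))
    (fun k => (hnn k).2) fun n => ?_
  have h1 : ∑ k ∈ Finset.range n, D (k + 1)
      ≤ q * ∑ k ∈ Finset.range n, D k + Λ' * R * ∑' j, τ j := by
    calc _ ≤ ∑ k ∈ Finset.range n, (q * D k + Λ' * R * τ k) := by
          refine Finset.sum_le_sum fun k _ => ?_
          rw [hD, mul_right_comm Λ' R]
          have := mul_le_mul_of_nonneg_left (hR k) (mul_nonneg hΛ' (hτ0 k))
          linarith
      _ = q * ∑ k ∈ Finset.range n, D k + Λ' * R * ∑ k ∈ Finset.range n, τ k := by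
          rw [Finset.sum_add_distrib, Finset.mul_sum, Finset.mul_sum]
      _ ≤ _ := by
          have : ∑ j ∈ Finset.range n, τ j ≤ ∑' j, τ j := hτ.sum_le_tsum _ fun j _ => hτ0 j
          gcongr
  have h2 := Finset.sum_range_succ' D n
  rw [Finset.sum_range_succ] at h2
  rw [le_div_iff₀ h1q]
  linarith [(hnn n).2]

/-! ### Summability of the oscillations -/

section Oscillation

variable {s N : ℕ} {M : Matrix (Fin s) (Fin s) ℤ} {E G : Finset (Fin s → ℤ)} {b : ℕ → Mask s}
  {B : ℝ} {τ : ℕ → ℝ} {c : (Fin s → ℤ) → ℝ}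

theorem isBoundedSeq_iterate (hM : M.det ≠ 0) (hb : ∀ k, (b k).SupportedIn N)
    (hB : ∀ k α, |b k α| ≤ B) (hc : IsBoundedSeq c) (k : ℕ) :
    IsBoundedSeq (iterate M b c k) := by
  induction k with
  | zero => exact hc
  | succ k ih =>
    obtain ⟨C, hC⟩ := ih
    exact ⟨_, fun α => abs_subdivision_le hM (hb k) (hB k) ((abs_nonneg _).trans (hC 0))
      fun β _ => hC β⟩

theorem reach_nonempty (hE : IsCosetReps M E) {P : Set (Fin s → ℤ)} (hP : P.Nonempty) :
    (reach M N E P).Nonempty := by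
  obtain ⟨p, hp⟩ := hP
  obtain ⟨ε, ⟨hε, y, hy⟩, -⟩ := hE p
  exact ⟨y, p, hp, 0, fun i => by simp, ε, hε, by rw [add_zero, hy, add_sub_cancel_left]⟩

theorem nonempty_of_isCosetReps (hE : IsCosetReps M E)
    (hG : ∀ α ∈ cube s N, ∀ ε ∈ E, α - ε ∈ G) : G.Nonempty := by
  obtain ⟨ε, ⟨hε, -⟩, -⟩ := hE 0
  exact ⟨0 - ε, hG 0 (fun i => by simp) ε hε⟩

/-- Completeness of `E` keeps the iterates of `reach` on `{0}` nonempty, and they end up in `K`. -/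
theorem indexSet_nonempty (hM : IsDilation M) (hE : IsCosetReps M E)
    (hG : ∀ α ∈ cube s N, ∀ ε ∈ E, α - ε ∈ G) : (indexSet hM G).Nonempty := by
  obtain ⟨n, hn⟩ := exists_reach_iterate_subset hM hG (nonempty_of_isCosetReps hE hG)
    (Set.finite_singleton 0)
  have h1 : ((reach M N E)^[n] {0}).Nonempty := by
    clear hn
    induction n with
    | zero => exact Set.singleton_nonempty 0
    | succ n ih =>
      rw [Function.iterate_succ_apply']
      exact reach_nonempty hE ih
  exact Finset.coe_nonempty.1 (h1.mono hn)

theorem exists_bound_and_summable_differences (hM : IsDilation M) (hE : IsCosetReps M E)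
    (hG : ∀ α ∈ cube s N, ∀ ε ∈ E, α - ε ∈ G) (hb : ∀ k, (b k).SupportedIn N)
    (hB : ∀ k α, |b k α| ≤ B) (hτ : Summable τ)
    (hbτ : ∀ k y, |subdivision M (b k) (fun _ => 1) y - 1| ≤ τ k)
    (hjsr : jointSpectralRadius (restrictedFamily M (indexSet hM G) E (limitPoints b)) < 1)
    (hc : IsBoundedSeq c) :
    (∃ C, ∀ k x, |iterate M b c k x| ≤ C) ∧ ∃ u : ℕ → ℝ, Summable u ∧ ∀ k x,
      ∀ κ ∈ indexSet hM G, ∀ κ' ∈ indexSet hM G,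
        |iterate M b c k (x - κ) - iterate M b c k (x - κ')| ≤ u k := by
  set K := indexSet hM G
  have hK : reach M N E K ⊆ K := reach_indexSet_subset hM hG
  obtain ⟨κ₀, hκ₀⟩ : K.Nonempty := indexSet_nonempty hM hE hG
  have hB0 : 0 ≤ B := (abs_nonneg _).trans (hB 0 0)
  have hτ0 : ∀ k, 0 ≤ τ k := fun k => (abs_nonneg _).trans (hbτ k 0)
  obtain ⟨ν, q, Cν, hq0, hq1, hCν, hν_ge, hν, hν_add, hν_contr⟩ := exists_adapted_norm
    (fun L hL => norm_le_of_mem_restrictedFamily (fun a ha α => abs_le_of_mem_limitPoints hB ha α)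
      hL) hjsr
  set Γ : ℝ := Cν * ((1 + K.card) * K.card) with hΓ
  have hΓ0 : 0 ≤ Γ := by positivity
  have h1q : 0 < 1 - q := by linarith
  -- Closeness `η` to the limit points uses at most half of the gap `1 - q`, so the perturbed factor
  -- `q + (1 - q) / 2` is still below `1`.
  set η : ℝ := (1 - q) / 2 / (Γ + 1) with hη
  have hη0 : 0 < η := by positivity
  have hηΓ : Cν * ((1 + K.card) * (η * K.card)) ≤ (1 - q) / 2 := by
    have h2 : Cν * ((1 + K.card) * (η * K.card)) = (1 - q) / 2 * (Γ / (Γ + 1)) := by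
      rw [hη, hΓ]
      ring
    rw [h2]
    exact mul_le_of_le_one_right (by positivity) ((div_le_one (by positivity)).2 (by linarith))
  obtain ⟨k₀, hk₀⟩ := eventually_atTop.1 (eventually_near_limitPoints hb hB hη0)
  choose R hR using isBoundedSeq_iterate hM.1 hb hB hc
  have hR0 : ∀ k, 0 ≤ R k := fun k => (abs_nonneg _).trans (hR k 0)
  set Λ : ℝ := Cν * ((1 + K.card) * B) with hΛ
  -- Majorants of the sup bound and of the window bound, started at the level `k₀` from which the
  -- masks are `η`-close to limit points.
  let X : ℕ → ℝ × ℝ := fun j => Nat.rec (R k₀, R k₀ * K.card) (fun j p =>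
    ((1 + τ (k₀ + j)) * p.1 + Λ * p.2, (q + (1 - q) / 2) * p.2 + K.card * τ (k₀ + j) * p.1)) j
  obtain ⟨⟨R', hR'⟩, hXC, hXD, hXs⟩ := exists_bound_and_summable_of_coupled
    (C := fun j => (X j).1) (D := fun j => (X j).2) (τ := fun j => τ (k₀ + j))
    (q := q + (1 - q) / 2) (Λ := Λ) (Λ' := K.card) (by linarith) (by linarith) (by positivity)
    (by positivity) (fun j => hτ0 _)
    (by simpa only [add_comm k₀] using (summable_nat_add_iff k₀).2 hτ) (hR0 k₀)
    (mul_nonneg (hR0 k₀) (by positivity)) (fun _ => rfl) (fun _ => rfl)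
  have hmain : ∀ j, (∀ x, |iterate M b c (k₀ + j) x| ≤ (X j).1) ∧
      ∀ x (v : diffSpace K), |windowPairing K (iterate M b c (k₀ + j)) x v| ≤ (X j).2 * ν v := by
    intro j
    induction j with
    | zero =>
      refine ⟨hR k₀, fun x v => ?_⟩
      change |windowPairing K (iterate M b c k₀) x v| ≤ R k₀ * K.card * ν v
      refine (abs_windowPairing_le (hR k₀) x (v : K → ℝ)).trans ?_
      rw [← mul_assoc]
      exact mul_le_mul_of_nonneg_left (hν_ge v) (mul_nonneg (hR0 k₀) (by positivity))
    | succ j ih =>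
      obtain ⟨ih1, ih2⟩ := ih
      obtain ⟨a, ha, hba⟩ := hk₀ (k₀ + j) (by omega)
      refine ⟨abs_subdivision_le_of_windows hE hK (hb _) (hB _) (hbτ _) ⟨κ₀, hκ₀⟩ hCν hν hν_add
        ih1 (hXD j) ih2, fun x v => ?_⟩
      refine (abs_windowPairing_subdivision_le hE hK (hb (k₀ + j)) (hbτ (k₀ + j))
        (supportedIn_of_mem_limitPoints hb ha)
        (subdivision_one_of_mem_limitPoints hM.1 hb hτ.tendsto_atTop_zero hbτ ha) hba ha
        ⟨κ₀, hκ₀⟩ hCν hν_ge hν hν_add hν_contr ih1 (hXD j) ih2 x v).trans ?_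
      refine mul_le_mul_of_nonneg_right ?_ ((norm_nonneg v).trans (hν_ge v))
      have h2 := hXD j
      change _ ≤ (q + (1 - q) / 2) * (X j).2 + K.card * τ (k₀ + j) * (X j).1
      gcongr
  set C := R' + ∑ k ∈ Finset.range k₀, R k with hC
  have hbound : ∀ k x, |iterate M b c k x| ≤ C := fun k x => by
    rcases lt_or_ge k k₀ with hk | hk
    · have h1 := Finset.single_le_sum (f := R) (fun k _ => hR0 k) (Finset.mem_range.2 hk)
      have h2 := (hXC 0).trans (hR' 0)
      linarith [hR k x]
    · obtain ⟨j, rfl⟩ := Nat.exists_eq_add_of_le hk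
      have h1 : 0 ≤ ∑ k ∈ Finset.range k₀, R k := Finset.sum_nonneg fun k _ => hR0 k
      linarith [(hmain j).1 x, hR' j]
  refine ⟨⟨C, hbound⟩, fun k => if k < k₀ then 2 * C else (X (k - k₀)).2 * (Cν * 2), ?_, ?_⟩
  · rw [← summable_nat_add_iff k₀]
    simpa using hXs.mul_right (Cν * 2)
  · intro k x κ hκ κ' hκ'
    by_cases hk : k < k₀
    · simp only [if_pos hk]
      have h1 := abs_sub (iterate M b c k (x - κ)) (iterate M b c k (x - κ'))
      linarith [hbound k (x - κ), hbound k (x - κ')]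
    · simp only [if_neg hk]
      obtain ⟨j, rfl⟩ := Nat.exists_eq_add_of_le (not_lt.1 hk)
      rw [Nat.add_sub_cancel_left]
      set v : K → ℝ := Pi.single ⟨κ, hκ⟩ 1 + (-1 : ℝ) • Pi.single ⟨κ', hκ'⟩ 1 with hv
      have hvm : v ∈ diffSpace K := by
        change ∑ α, v α = 0
        simp [hv, Finset.sum_add_distrib, Pi.single_apply]
      have h1 := (hmain j).2 x ⟨v, hvm⟩
      have h3 : windowPairing K (iterate M b c (k₀ + j)) x v
          = iterate M b c (k₀ + j) (x - κ) - iterate M b c (k₀ + j) (x - κ') := by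
        rw [hv, windowPairing_add, windowPairing_smul, windowPairing_single,
          windowPairing_single, neg_one_mul, ← sub_eq_add_neg]
      rw [h3] at h1
      refine h1.trans (mul_le_mul_of_nonneg_left ((hν _).trans ?_) (hXD j))
      refine mul_le_mul_of_nonneg_left ?_ hCν
      change ‖v‖ ≤ 2
      have h2 := norm_add_le (Pi.single ⟨κ, hκ⟩ 1 : K → ℝ) ((-1 : ℝ) • Pi.single ⟨κ', hκ'⟩ 1)
      rw [norm_smul, norm_neg, norm_one, one_mul] at h2
      linarith [norm_single_one_le (⟨κ, hκ⟩ : K), norm_single_one_le (⟨κ', hκ'⟩ : K)]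

/-- The oscillations of the sequences `c k` over the windows `x - P` are summable in `k`. -/
def SummableOscillation (c : ℕ → (Fin s → ℤ) → ℝ) (P : Set (Fin s → ℤ)) : Prop :=
  ∃ u : ℕ → ℝ, Summable u ∧ (∀ k, 0 ≤ u k) ∧
    ∀ k x, ∀ p ∈ P, ∀ p' ∈ P, |c k (x - p) - c k (x - p')| ≤ u k

theorem SummableOscillation.mono {c : ℕ → (Fin s → ℤ) → ℝ} {P Q : Set (Fin s → ℤ)}
    (h : SummableOscillation c Q) (hPQ : P ⊆ Q) : SummableOscillation c P := by
  obtain ⟨u, hu, hu0, huc⟩ := h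
  exact ⟨u, hu, hu0, fun k x p hp p' hp' => huc k x p (hPQ hp) p' (hPQ hp')⟩

/-- Data of level `k + 1` on `ε + Mx' - P` are computed from data of level `k` on `x' - reach P`.
Small oscillation there passes on, with one shift of the index and an error of order `τ k`. -/
theorem SummableOscillation.of_reach (hM : M.det ≠ 0) (hE : IsCosetReps M E)
    (hb : ∀ k, (b k).SupportedIn N) (hB : ∀ k α, |b k α| ≤ B) (hτ : Summable τ)
    (hbτ : ∀ k y, |subdivision M (b k) (fun _ => 1) y - 1| ≤ τ k)
    {C : ℝ} (hC : ∀ k x, |iterate M b c k x| ≤ C) {P : Set (Fin s → ℤ)}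
    (h : SummableOscillation (iterate M b c) (reach M N E P)) :
    SummableOscillation (iterate M b c) P := by
  obtain ⟨u, hu, hu0, huc⟩ := h
  have hC0 : 0 ≤ C := (abs_nonneg _).trans (hC 0 0)
  have hB0 : 0 ≤ B := (abs_nonneg _).trans (hB 0 0)
  have hτ0 : ∀ k, 0 ≤ τ k := fun k => (abs_nonneg _).trans (hbτ k 0)
  set w : ℕ → ℝ := fun k => (cubeFinset s N).card * B * u k + τ k * C with hw
  have hws : Summable w := (hu.mul_left _).add (hτ.mul_right _)
  refine ⟨fun k => Nat.casesOn k (2 * C) fun k => 2 * w k, ?_, fun k => ?_,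
    fun k x p hp p' hp' => ?_⟩
  · rw [← summable_nat_add_iff 1]
    exact hws.mul_left 2
  · cases k with
    | zero => exact mul_nonneg zero_le_two hC0
    | succ k =>
      have := hu0 k
      have := hτ0 k
      simp only [hw]
      positivity
  · cases k with
    | zero =>
      have h1 := abs_sub (iterate M b c 0 (x - p)) (iterate M b c 0 (x - p'))
      change _ ≤ 2 * C
      linarith [hC 0 (x - p), hC 0 (x - p')]
    | succ k =>
      change _ ≤ 2 * w k
      obtain ⟨ε, ⟨hε, x', rfl⟩, -⟩ := hE x
      -- A common reference value for the whole window; if nothing is reached, `0` serves.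
      obtain ⟨r, hrC, hr⟩ : ∃ r, |r| ≤ C ∧
          ∀ α ∈ reach M N E P, |iterate M b c k (x' - α) - r| ≤ u k := by
        rcases (reach M N E P).eq_empty_or_nonempty with h | ⟨α₀, hα₀⟩
        · exact ⟨0, by simpa using hC0, by simp [h]⟩
        · exact ⟨_, hC k (x' - α₀), fun α hα => huc k x' α hα α₀ hα₀⟩
      have key : ∀ p ∈ P, |iterate M b c (k + 1) (ε + M *ᵥ x' - p) - r| ≤ w k := by
        intro p hp
        refine (abs_subdivision_sub_le hM (hb k) (hB k) (hbτ k _) (H := u k) (hu0 k)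
          fun β hβ => ?_).trans ?_
        · have h1 := hr (x' - β) ⟨p, hp, _, hβ, ε, hε, by rw [Matrix.mulVec_sub]; abel⟩
          rwa [sub_sub_cancel] at h1
        · exact add_le_add_right (mul_le_mul_of_nonneg_left hrC (hτ0 k)) _
      have h1 := abs_sub_le (iterate M b c (k + 1) (ε + M *ᵥ x' - p)) r
        (iterate M b c (k + 1) (ε + M *ᵥ x' - p'))
      have h2 := key p' hp'
      rw [abs_sub_comm] at h2
      linarith [key p hp]

theorem SummableOscillation.of_reach_iterate (hM : M.det ≠ 0) (hE : IsCosetReps M E)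
    (hb : ∀ k, (b k).SupportedIn N) (hB : ∀ k α, |b k α| ≤ B) (hτ : Summable τ)
    (hbτ : ∀ k y, |subdivision M (b k) (fun _ => 1) y - 1| ≤ τ k)
    {C : ℝ} (hC : ∀ k x, |iterate M b c k x| ≤ C) (n : ℕ) {P : Set (Fin s → ℤ)}
    (h : SummableOscillation (iterate M b c) ((reach M N E)^[n] P)) :
    SummableOscillation (iterate M b c) P := by
  induction n with
  | zero => exact h
  | succ n ih =>
    rw [Function.iterate_succ_apply'] at h
    exact ih (h.of_reach hM hE hb hB hτ hbτ hC)

/-- The data are uniformly bounded and their variation over bounded distances is summable. -/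
theorem exists_bound_and_summable_variation (hM : IsDilation M) (hE : IsCosetReps M E)
    (hG : ∀ α ∈ cube s N, ∀ ε ∈ E, α - ε ∈ G) (hb : ∀ k, (b k).SupportedIn N)
    (hB : ∀ k α, |b k α| ≤ B) (hτ : Summable τ)
    (hbτ : ∀ k y, |subdivision M (b k) (fun _ => 1) y - 1| ≤ τ k)
    (hjsr : jointSpectralRadius (restrictedFamily M (indexSet hM G) E (limitPoints b)) < 1)
    (hc : IsBoundedSeq c) :
    (∃ C, ∀ k x, |iterate M b c k x| ≤ C) ∧ ∀ R : ℝ, 0 ≤ R → ∃ u : ℕ → ℝ, Summable u ∧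
      (∀ k, 0 ≤ u k) ∧ ∀ k y z, ‖realVec y - realVec z‖ ≤ R →
        |iterate M b c k y - iterate M b c k z| ≤ u k := by
  obtain ⟨⟨C, hC⟩, u, hu, huc⟩ :=
    exists_bound_and_summable_differences hM hE hG hb hB hτ hbτ hjsr hc
  refine ⟨⟨C, hC⟩, fun R hR => ?_⟩
  obtain ⟨n, hn⟩ := exists_reach_iterate_subset hM hG (nonempty_of_isCosetReps hE hG)
    (finite_realVec_norm_le (s := s) R)
  have hKosc : SummableOscillation (iterate M b c) (indexSet hM G) := by
    obtain ⟨κ, hκ⟩ := indexSet_nonempty hM hE hG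
    exact ⟨u, hu, fun k => (abs_nonneg _).trans (huc k 0 κ hκ κ hκ), fun k x p hp p' hp' =>
      huc k x p hp p' hp'⟩
  obtain ⟨w, hw, hw0, hwc⟩ :=
    (hKosc.mono hn).of_reach_iterate hM.1 hE hb hB hτ hbτ hC n
  refine ⟨w, hw, hw0, fun k y z hyz => ?_⟩
  -- The window at `y` over the ball of radius `R` contains both `y = y - 0` and `z = y - (y - z)`.
  have h1 := hwc k y 0 (by
    have : realVec (0 : Fin s → ℤ) = 0 := by ext; simp [realVec]
    simpa [this] using hR) (y - z) (by simpa [realVec_sub] using hyz)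
  simpa using h1

end Oscillation

/-! ### Convergence -/

/-- The lattice point with coordinates `⌊x i⌋`. -/
noncomputable def latticeFloor {s : ℕ} (x : Fin s → ℝ) : Fin s → ℤ := fun i => ⌊x i⌋

theorem norm_sub_latticeFloor_le {s : ℕ} (x : Fin s → ℝ) :
    ‖x - realVec (latticeFloor x)‖ ≤ 1 := by
  rw [pi_norm_le_iff_of_nonneg zero_le_one]
  intro i
  rw [Pi.sub_apply, realVec, latticeFloor, Real.norm_eq_abs, abs_le]
  constructor <;> linarith [Int.floor_le (x i), Int.lt_floor_add_one (x i)]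

/-- A partition of unity reproduces a sequence up to its local variation. -/
theorem exists_abs_tsum_sub_le {s : ℕ} {f : (Fin s → ℝ) → ℝ} (hf : IsTestFunction f) :
    ∃ R A : ℝ, 0 ≤ R ∧ 0 ≤ A ∧ ∀ (c : (Fin s → ℤ) → ℝ) (u : ℝ), 0 ≤ u →
      (∀ y z, ‖realVec y - realVec z‖ ≤ R → |c y - c z| ≤ u) → ∀ x : Fin s → ℝ,
        |∑' α : Fin s → ℤ, c α * f (x - realVec α) - c (latticeFloor x)| ≤ A * u := by
  obtain ⟨R, hR0, hR⟩ := exists_eq_zero_of_lt_norm hf.hasCompactSupport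
  obtain ⟨F, hF⟩ := hf.continuous.bounded_above_of_compact_support hf.hasCompactSupport
  have hF0 : 0 ≤ F := (norm_nonneg _).trans (hF 0)
  have hfin := finite_realVec_norm_le (s := s) (R + 1)
  -- The extra `1` is the distance from `x` to its lattice floor; the cardinality bounds the number
  -- of translates that can be nonzero at `x`.
  refine ⟨R + 1, hfin.toFinset.card * F, by linarith, by positivity, fun c u hu hc x => ?_⟩
  set z := latticeFloor x
  have hsupp := finite_support_shifts hf.hasCompactSupport x
  have hs1 : Summable fun α : Fin s → ℤ => c α * f (x - realVec α) :=
    summable_of_hasFiniteSupport (hsupp.subset fun α hα => right_ne_zero_of_mul hα)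
  have hs2 : Summable fun α : Fin s → ℤ => c z * f (x - realVec α) :=
    summable_of_hasFiniteSupport (hsupp.subset fun α hα => right_ne_zero_of_mul hα)
  have h1 : ∑' α : Fin s → ℤ, c α * f (x - realVec α) - c z
      = ∑' α : Fin s → ℤ, (c α - c z) * f (x - realVec α) := by
    calc _ = ∑' α : Fin s → ℤ, c α * f (x - realVec α)
          - ∑' α : Fin s → ℤ, c z * f (x - realVec α) := by
          rw [tsum_mul_left, hf.tsum_shifts_eq_one, mul_one]
      _ = _ := by
          rw [← hs1.tsum_sub hs2]
          simp only [sub_mul]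
  have hnear : ∀ α : Fin s → ℤ, R + 1 < ‖realVec α - realVec z‖ → f (x - realVec α) = 0 := by
    intro α hα
    refine hR _ ?_
    have h2 := norm_add_le (x - realVec z) (realVec α - x)
    rw [norm_sub_rev (realVec α) x] at h2
    have h3 : x - realVec z + (realVec α - x) = realVec α - realVec z := by abel
    rw [h3] at h2
    linarith [norm_sub_latticeFloor_le x]
  have h2 : ∑' α : Fin s → ℤ, (c α - c z) * f (x - realVec α)
      = ∑ α ∈ hfin.toFinset, (c (α + z) - c z) * f (x - realVec (α + z)) := by
    rw [← (Equiv.addRight z).tsum_eq]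
    refine tsum_eq_sum fun α hα => ?_
    rw [Equiv.coe_addRight, hnear, mul_zero]
    rw [realVec_add, add_sub_cancel_right]
    simpa using hα
  rw [h1, h2, mul_assoc]
  refine (Finset.abs_sum_le_sum_abs _ _).trans ?_
  rw [← nsmul_eq_mul, ← Finset.sum_const]
  refine Finset.sum_le_sum fun α hα => ?_
  rw [abs_mul, mul_comm]
  refine mul_le_mul (hF _) (hc _ _ ?_) (abs_nonneg _) hF0
  rw [realVec_add, add_sub_cancel_right]
  simpa using hα

section Convergence

variable {s N : ℕ} {M : Matrix (Fin s) (Fin s) ℤ} {b : ℕ → Mask s} {B : ℝ} {τ : ℕ → ℝ}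
  {c : (Fin s → ℤ) → ℝ}

/-- The parents of the lattice floor of `M x` lie close to the lattice floor of `x`. -/
theorem exists_norm_sub_latticeFloor_le (hM : IsDilation M) (N : ℕ) :
    ∃ R : ℝ, 0 ≤ R ∧ ∀ (x : Fin s → ℝ) (β : Fin s → ℤ),
      latticeFloor (realMat M *ᵥ x) - M *ᵥ β ∈ cube s N →
        ‖realVec β - realVec (latticeFloor x)‖ ≤ R := by
  obtain ⟨u, -, hub⟩ := summable_norm_inv_pow_mulVec hM
  refine ⟨|u 0| * (1 + N) + 1, by positivity, fun x β hβ => ?_⟩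
  set y := latticeFloor (realMat M *ᵥ x) with hy
  set q := y - M *ᵥ β with hq
  have hqn : ‖realVec q‖ ≤ N := by
    rw [pi_norm_le_iff_of_nonneg (by positivity)]
    intro i
    rw [Real.norm_eq_abs, realVec, abs_le]
    obtain ⟨h1, h2⟩ := hβ i
    have h1' : (0 : ℝ) ≤ q i := by exact_mod_cast h1
    have h2' : (q i : ℝ) ≤ N := by exact_mod_cast h2
    constructor <;> linarith [Nat.cast_nonneg (α := ℝ) N]
  have h1 : realVec β - x
      = -((realMat M)⁻¹ ^ (0 + 1) *ᵥ (realMat M *ᵥ x - realVec y + realVec q)) := by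
    have h2 : realMat M *ᵥ x - realVec y + realVec q = realMat M *ᵥ (x - realVec β) := by
      rw [hq, realVec_sub, realVec_mulVec, Matrix.mulVec_sub]
      abel
    rw [h2, zero_add, pow_one, Matrix.mulVec_mulVec,
      Matrix.nonsing_inv_mul _ (isUnit_realMat_det hM.1), Matrix.one_mulVec, neg_sub]
  have h3 : ‖realVec β - x‖ ≤ |u 0| * (1 + N) := by
    rw [h1, norm_neg]
    refine (hub 0 _).trans ?_
    refine mul_le_mul (le_abs_self _) ((norm_add_le _ _).trans
      (add_le_add (norm_sub_latticeFloor_le _) hqn)) (norm_nonneg _) (abs_nonneg _)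
  have h4 := norm_add_le (realVec β - x) (x - realVec (latticeFloor x))
  rw [sub_add_sub_cancel] at h4
  linarith [norm_sub_latticeFloor_le x]

/-- A scheme with bounded data, summable local variation and summable defects in the sum rules
converges. -/
theorem exists_continuous_limit (hM : IsDilation M) (hb : ∀ k, (b k).SupportedIn N)
    (hB : ∀ k α, |b k α| ≤ B) (hτ : Summable τ)
    (hbτ : ∀ k y, |subdivision M (b k) (fun _ => 1) y - 1| ≤ τ k)
    {C : ℝ} (hC : ∀ k x, |iterate M b c k x| ≤ C)
    (hvar : ∀ R : ℝ, 0 ≤ R → ∃ u : ℕ → ℝ, Summable u ∧ (∀ k, 0 ≤ u k) ∧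
      ∀ k y z, ‖realVec y - realVec z‖ ≤ R → |iterate M b c k y - iterate M b c k z| ≤ u k) :
    ∃ g : (Fin s → ℝ) → ℝ, Continuous g ∧ ∀ f : (Fin s → ℝ) → ℝ, IsTestFunction f →
      TendstoUniformly (fun (k : ℕ) (x : Fin s → ℝ) =>
        ∑' α : Fin s → ℤ, iterate M b c k α * f ((realMat M) ^ k *ᵥ x - realVec α)) g atTop := by
  -- Step functions independent of any test function. The value at level `k + 1` is computed from
  -- data near the floor at level `k`, so consecutive differences are summable uniformly in `x`.
  let γ : ℕ → (Fin s → ℝ) → ℝ := fun k x =>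
    iterate M b c k (latticeFloor ((realMat M) ^ k *ᵥ x))
  have hτ0 : ∀ k, 0 ≤ τ k := fun k => (abs_nonneg _).trans (hbτ k 0)
  obtain ⟨w, hw, hγ⟩ : ∃ w : ℕ → ℝ, Summable w ∧ ∀ k x, dist (γ k x) (γ (k + 1) x) ≤ w k := by
    obtain ⟨R, hR0, hR⟩ := exists_norm_sub_latticeFloor_le hM N
    obtain ⟨u, hu, hu0, huc⟩ := hvar R hR0
    refine ⟨fun k => (cubeFinset s N).card * B * u k + τ k * C,
      (hu.mul_left _).add (hτ.mul_right _), fun k x => ?_⟩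
    rw [dist_comm, Real.dist_eq]
    simp only [γ]
    rw [pow_succ', ← Matrix.mulVec_mulVec]
    refine (abs_subdivision_sub_le hM.1 (hb k) (hB k) (hbτ k _) (hu0 k)
      fun β hβ => huc k _ _ (hR _ β hβ)).trans ?_
    exact add_le_add_right (mul_le_mul_of_nonneg_left (hC k _) (hτ0 k)) _
  have hlim : ∀ x, ∃ y, Tendsto (fun k => γ k x) atTop (𝓝 y) := fun x =>
    cauchySeq_tendsto_of_complete
      (cauchySeq_of_dist_le_of_summable w (fun k => hγ k x) hw)
  choose g hg using hlim
  set t : ℕ → ℝ := fun k => ∑' j, w (k + j) with ht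
  have hgt : ∀ k x, |γ k x - g x| ≤ t k := fun k x =>
    dist_le_tsum_of_dist_le_of_tendsto w (fun k => hγ k x) hw (hg x) k
  have ht0 : Tendsto t atTop (𝓝 0) := by
    have := tendsto_sum_nat_add w
    simpa only [ht, add_comm] using this
  refine ⟨g, ?_, fun f hf => ?_⟩
  · obtain ⟨u, hu, hu0, huc⟩ := hvar 3 (by norm_num)
    rw [Metric.continuous_iff']
    intro x ε hε
    have h1 : Tendsto (fun k => t k + t k + u k) atTop (𝓝 0) := by
      simpa using (ht0.add ht0).add hu.tendsto_atTop_zero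
    obtain ⟨k, hk⟩ := (h1.eventually (gt_mem_nhds hε)).exists
    have hcont : Continuous fun y : Fin s → ℝ => (realMat M) ^ k *ᵥ y :=
      continuous_const.matrix_mulVec continuous_id
    filter_upwards [hcont.continuousAt (x := x) (Metric.ball_mem_nhds _ one_pos)] with y hy
    have hy' : ‖(realMat M) ^ k *ᵥ y - (realMat M) ^ k *ᵥ x‖ < 1 := by
      simpa [dist_eq_norm] using hy
    have h2 : |γ k y - γ k x| ≤ u k := by
      refine huc k _ _ ?_
      set Y := (realMat M) ^ k *ᵥ y
      set X := (realMat M) ^ k *ᵥ x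
      have h3 : realVec (latticeFloor Y) - realVec (latticeFloor X)
          = (X - realVec (latticeFloor X)) - (Y - realVec (latticeFloor Y)) + (Y - X) := by abel
      rw [h3]
      refine (norm_add_le _ _).trans ?_
      have h4 := norm_sub_le (X - realVec (latticeFloor X)) (Y - realVec (latticeFloor Y))
      linarith [norm_sub_latticeFloor_le X, norm_sub_latticeFloor_le Y]
    rw [Real.dist_eq]
    have h5 := abs_le.1 (hgt k y)
    have h6 := abs_le.1 (hgt k x)
    have h7 := abs_le.1 h2
    rw [abs_lt]
    constructor <;> linarith [h5.1, h5.2, h6.1, h6.2, h7.1, h7.2]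
  · obtain ⟨R, A, hR0, hA0, hRA⟩ := exists_abs_tsum_sub_le hf
    obtain ⟨u, hu, hu0, huc⟩ := hvar R hR0
    rw [Metric.tendstoUniformly_iff]
    intro ε hε
    have h1 : Tendsto (fun k => A * u k + t k) atTop (𝓝 0) := by
      simpa using (hu.tendsto_atTop_zero.const_mul A).add ht0
    filter_upwards [h1.eventually (gt_mem_nhds hε)] with k hk x
    have h2 := hRA (iterate M b c k) (u k) (hu0 k) (huc k) ((realMat M) ^ k *ᵥ x)
    rw [dist_comm, Real.dist_eq]
    refine lt_of_le_of_lt ((abs_sub_le _ (γ k x) _).trans (add_le_add h2 (hgt k x))) hk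

end Convergence

end NonstationarySubdivision

open NonstationarySubdivision in
theorem corollary2 {s : ℕ} (hs : 0 < s) (N : ℕ)
    (M : Matrix (Fin s) (Fin s) ℤ) (hM : IsDilation M)
    (E : Finset (Fin s → ℤ)) (hE : IsCosetReps M E)
    (G : Finset (Fin s → ℤ)) (hG : ∀ α ∈ cube s N, ∀ ε ∈ E, α - ε ∈ G)
    (a b : ℕ → Mask s)
    (ha : ∀ k, (a k).SupportedIn N) (hb : ∀ k, (b k).SupportedIn N)
    (hb_bdd : ∃ C : ℝ, ∀ k α, |b k α| ≤ C)
    (ha_conv : C0Convergent M a)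
    (ha_jsr : jointSpectralRadius
      (restrictedFamily M (indexSet hM G) E (limitPoints a)) < 1)
    (hab : AsymptoticallySimilar a b)
    (hb_sum : ApproxSumRules M b) :
    C0Convergent M b := by
  obtain ⟨B, hB⟩ := hb_bdd
  have hab' : limitPoints a = limitPoints b := hab
  rw [hab'] at ha_jsr
  -- The error sequence `τ` of the whole argument is the sum of both defects.
  have hτ := hb_sum.1.add hb_sum.2
  have hbτ := fun k y => abs_subdivision_one_sub_one_le hM.1 (hb k) y
  intro c hc
  obtain ⟨⟨C, hC⟩, hvar⟩ :=
    exists_bound_and_summable_variation hM hE hG hb hB hτ hbτ ha_jsr hc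
  exact exists_continuous_limit hM hb hB hτ hbτ hC hvar
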